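/- Let $G=(V,E)$ be a finite connected graph on $n$ vertices that is locally connected, i.e. for every vertex $v$ the neighbourhood of $v$ induces a (nonempty) connected graph. Let $d$ be the shortest-path metric of $G$. For distinct $a,b\in V$, the line $\overline{ab}$ is the set consisting of $a$, $b$ and all vertices $c\notin\{a,b\}$ such that one of $d(a,b)=d(a,c)+d(c,b)$, $d(c,b)=d(c,a)+d(a,b)$, $d(a,c)=d(a,b)+d(b,c)$ holds, i.e. such that some shortest path contains $a$, $b$ and $c$. The number of lines of $G$ is the number of distinct sets of the form $\overline{ab}$ with $a\neq b$. (1) If $n\ge 3$, then $G$ has fewer than $n$ lines if and only if $G$ is isomorphic to one of the complete multipartite graphs $K_{1,2,2}$, $K_{2,2,2}$, $K_{2,2,2,2}$. (2) Consequently the Chen–Chvátal conjecture holds for $G$: either $G$ has at least $n$ lines, or some line of $G$ is universal, i.e. equal to $V$. -/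

import Mathlib

namespace SimpleGraph

/-- `G.Btw a b c`: the vertices `a`, `b`, `c` are distinct and `b` lies on a shortest path
between `a` and `c`, expressed through the graph distance. -/
def Btw {V : Type*} (G : SimpleGraph V) (a b c : V) : Prop :=
  a ≠ b ∧ b ≠ c ∧ a ≠ c ∧ G.dist a c = G.dist a b + G.dist b c

/-- The line defined by `a` and `b`: the points `a` and `b` themselves, together with every vertex
`c` such that one of `a`, `b`, `c` is between the other two. -/
def line {V : Type*} (G : SimpleGraph V) (a b : V) : Set V :=
  {c | c = a ∨ c = b ∨ G.Btw c a b ∨ G.Btw a c b ∨ G.Btw a b c}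

/-- The set of all lines of `G` (equal lines defined by different pairs are counted once). -/
def lines {V : Type*} (G : SimpleGraph V) : Set (Set V) :=
  {L | ∃ a b : V, a ≠ b ∧ L = G.line a b}

/-- The neighbourhood of every vertex induces a connected graph. -/
def LocallyConnected {V : Type*} (G : SimpleGraph V) : Prop :=
  ∀ v : V, (G.induce (G.neighborSet v)).Connected

end SimpleGraph

/-- The complete multipartite graph `K_{1,2,2}`. -/
abbrev K122 : SimpleGraph (Σ i : Fin 3, Fin (![1, 2, 2] i)) :=
  SimpleGraph.completeMultipartiteGraph (fun i : Fin 3 => Fin (![1, 2, 2] i))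

/-- The complete multipartite graph `K_{2,2,2}`. -/
abbrev K222 : SimpleGraph (Σ _ : Fin 3, Fin 2) :=
  SimpleGraph.completeMultipartiteGraph (fun _ : Fin 3 => Fin 2)

/-- The complete multipartite graph `K_{2,2,2,2}`. -/
abbrev K2222 : SimpleGraph (Σ _ : Fin 4, Fin 2) :=
  SimpleGraph.completeMultipartiteGraph (fun _ : Fin 4 => Fin 2)

/-!
Write `d` for the distance of `G`. The proof rests on one observation about two equal lines through
a common vertex, a double count over all lines when `G` has no false twins, and an induction that
removes false twins (distinct vertices with the same neighbourhood).

*Equal lines.* Suppose that the lines `v x` and `v y` are equal. A neighbour `t` of `x` is on the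
line `v x` exactly when `d t v ≠ d x v`. Comparing with the line `v y` shows that no neighbour of
`x` is as far from `y` as `x` is; as the neighbourhood of `x` is connected and distances to `y`
change by at most one along its edges, all neighbours of `x` are on the same side. This excludes
that `x` is between `v` and `y`, so that `v` is between `x` and `y`
(`LocallyConnected.dist_eq_of_line_eq`), and no shortest path from `y` extends beyond `x`
(`LocallyConnected.eq_of_dist_eq_add`). Unless `x` and `y` are false twins, no shortest path from
`v` extends beyond `x` either (`LocallyConnected.eq_of_dist_eq_add_center`).

*No false twins.* Each ordered pair of distinct vertices generates one line, so it suffices that a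
line `L` is generated by at most `n` ordered pairs
(`LocallyConnected.sum_card_partners_le`), and some line by fewer
(`LocallyConnected.exists_sum_card_partners_lt`). The pairs generating `L` form disjoint stars. A
star with centre `v` and two leaves is compensated by a neighbour of `v` off `L`, and a star with
more leaves by neighbours of `v` towards the leaves, which generate `L` with no vertex at all;
different stars are far enough apart for these vertices to be distinct. If `v x = v y`, then the
line `x y` is generated by disjoint pairs that avoid `v`; if this never happens, then the same holds
for the line of an edge and the apex of a triangle over it.

*False twins.* If the false twins `x` and `z` have a further common non-neighbour `u`, then `G - z`
is again connected and locally connected, with the same distances, and the line `z u`, which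
contains `z` but not `x`, is lost (`Connected.ncard_lines_removed_lt`). Otherwise `G` is the join of
`g` pairs of non-adjacent vertices and a graph on `w` vertices without false twins. Then
`g * w + g.choose 2 + 1` lines can be listed (`TwinsDominate.card_twinLines`), and this is enough
except for `(g, w) = (2, 1), (3, 0), (4, 0)`, which are the three exceptional graphs.
-/

namespace SimpleGraph

variable {V : Type*} {G : SimpleGraph V}

/-! ### Distances and lines -/

theorem Adj.dist_eq_one {a b : V} (h : G.Adj a b) : G.dist a b = 1 :=
  dist_eq_one_iff_adj.2 h

theorem Btw.symm {a b c : V} (h : G.Btw a b c) : G.Btw c b a :=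
  ⟨h.2.1.symm, h.1.symm, h.2.2.1.symm, by
    rw [dist_comm, h.2.2.2, add_comm, dist_comm (u := b), dist_comm (u := a)]⟩

theorem btw_comm {a b c : V} : G.Btw a b c ↔ G.Btw c b a := ⟨Btw.symm, Btw.symm⟩

theorem line_comm (a b : V) : G.line a b = G.line b a := by
  ext c
  change (c = a ∨ c = b ∨ _) ↔ (c = b ∨ c = a ∨ _)
  rw [btw_comm (a := c) (b := a), btw_comm (a := a) (b := c), btw_comm (a := a) (b := b)]
  tauto

/-- For `a ≠ b`, the distinctness conditions of `Btw` can be dropped from the definition of the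
line `a b`. -/
theorem mem_line_iff {a b : V} (hab : a ≠ b) (c : V) :
    c ∈ G.line a b ↔ G.dist a b = G.dist a c + G.dist c b ∨
      G.dist a c = G.dist a b + G.dist b c ∨ G.dist c b = G.dist c a + G.dist a b := by
  simp only [line, Btw, Set.mem_ofPred_eq]
  by_cases h1 : c = a
  · subst h1; simp
  by_cases h2 : c = b
  · subst h2; simp
  have h1' : a ≠ c := Ne.symm h1
  have h2' : b ≠ c := Ne.symm h2
  simp only [h1, h2, h1', h2', hab, ne_eq, not_false_eq_true, true_and, false_or]
  tauto

theorem left_mem_line (a b : V) : a ∈ G.line a b := Or.inl rfl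

theorem right_mem_line (a b : V) : b ∈ G.line a b := Or.inr (Or.inl rfl)

/-- A shortest path from `x` to `y` starts with a neighbour of `x` that is closer to `y`. -/
theorem Connected.exists_adj_dist (hc : G.Connected) {x y : V} (h : x ≠ y) :
    ∃ t, G.Adj x t ∧ G.dist x y = G.dist t y + 1 := by
  obtain ⟨p, hp⟩ := hc.exists_walk_length_eq_dist x y
  cases p with
  | nil => exact absurd rfl h
  | cons ha q =>
    rename_i t
    refine ⟨t, ha, ?_⟩
    have h1 := dist_le q
    have h2 := hc.dist_triangle (u := x) (v := t) (w := y)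
    have h3 := ha.dist_eq_one
    simp only [Walk.length_cons] at hp
    omega

theorem Connected.adj_dist_le (hc : G.Connected) {x t : V} (h : G.Adj x t) (y : V) :
    G.dist x y ≤ G.dist t y + 1 ∧ G.dist t y ≤ G.dist x y + 1 := by
  have h1 := hc.dist_triangle (u := x) (v := t) (w := y)
  have h2 := hc.dist_triangle (u := t) (v := x) (w := y)
  have h3 := h.dist_eq_one
  have h4 := h.symm.dist_eq_one
  omega

/-- The line of an edge consists of the vertices that are not equidistant from its ends. -/
theorem Connected.mem_line_adj (hc : G.Connected) {a b : V} (h : G.Adj a b) (c : V) :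
    c ∈ G.line a b ↔ G.dist a c ≠ G.dist b c := by
  rw [mem_line_iff h.ne]
  have := hc.adj_dist_le h c
  have := h.dist_eq_one
  have := G.dist_comm (u := c) (v := b)
  have := G.dist_comm (u := c) (v := a)
  omega

/-- A neighbour `t` of `x` is off the line `v x` exactly when it is as far from `v` as `x` is. -/
theorem Connected.mem_line_of_adj (hc : G.Connected) {x t : V} (h : G.Adj x t) {v : V}
    (hv : v ≠ x) : t ∈ G.line v x ↔ G.dist t v ≠ G.dist x v := by
  rw [mem_line_iff hv]
  have := hc.adj_dist_le h v
  have := h.dist_eq_one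
  have := h.symm.dist_eq_one
  have := hc.pos_dist_of_ne hv
  have := G.dist_comm (u := v) (v := x)
  have := G.dist_comm (u := v) (v := t)
  omega

/-- A property of the neighbours of `x` that holds for some and fails for others changes along an
edge of the neighbourhood. -/
theorem LocallyConnected.exists_adj_of_mem_of_not_mem (hl : G.LocallyConnected) {x : V}
    (S : Set V) {t s : V} (ht : G.Adj x t) (hs : G.Adj x s) (htS : t ∈ S) (hsS : s ∉ S) :
    ∃ a b, G.Adj x a ∧ G.Adj x b ∧ G.Adj a b ∧ a ∈ S ∧ b ∉ S := by
  obtain ⟨p⟩ := (hl x).preconnected ⟨t, ht⟩ ⟨s, hs⟩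
  obtain ⟨d, -, h1, h2⟩ := p.exists_boundary_dart (Subtype.val ⁻¹' S) htS hsS
  exact ⟨d.fst, d.snd, d.fst.2, d.snd.2, d.adj, h1, h2⟩

/-- If no neighbour of `x` is as far from `y` as `x` is, then all of them are closer to `y`:
distances to `y` within the connected neighbourhood of `x` change by at most one along an edge. -/
theorem LocallyConnected.dist_eq_of_forall_ne (hl : G.LocallyConnected) (hc : G.Connected)
    {x y : V} (hxy : x ≠ y) (h : ∀ t, G.Adj x t → G.dist t y ≠ G.dist x y) {t : V}
    (ht : G.Adj x t) : G.dist x y = G.dist t y + 1 := by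
  obtain ⟨s, hs, hsd⟩ := hc.exists_adj_dist hxy
  by_contra hne
  obtain ⟨a, b, ha, hb, hab, h1, h2⟩ := hl.exists_adj_of_mem_of_not_mem
    {r | G.dist x y = G.dist r y + 1} hs ht hsd hne
  simp only [Set.mem_ofPred_eq] at h1 h2
  have := hc.adj_dist_le hab y
  have := hc.adj_dist_le hb y
  have := h b hb
  omega

/-! ### Two equal lines through a common vertex -/

/-- If `x` lies strictly between `v` and `y`, then the lines `v x` and `v y` differ: otherwise no
neighbour of `x` would be at distance `dist x y` from `y`, although some are closer and some are
farther. -/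
theorem LocallyConnected.dist_ne_of_line_eq (hl : G.LocallyConnected) (hc : G.Connected)
    {v x y : V} (hxv : x ≠ v) (hyv : y ≠ v) (hxy : x ≠ y) (hL : G.line v x = G.line v y) :
    G.dist v y ≠ G.dist v x + G.dist x y := by
  intro hd
  have hne : ∀ t, G.Adj x t → G.dist t y ≠ G.dist x y := by
    intro t ht hty
    have h1 := hc.mem_line_of_adj ht hxv.symm
    have h2 := mem_line_iff (G := G) hyv.symm t
    rw [hL] at h1
    have h3 := h1.symm.trans h2
    have h4 := hc.adj_dist_le ht v
    have h5 := hc.dist_triangle (u := v) (v := t) (w := y)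
    have h6 := hc.pos_dist_of_ne hxy
    have h7 := hc.pos_dist_of_ne hxv
    have := G.dist_comm (u := v) (v := x)
    have := G.dist_comm (u := v) (v := t)
    have := G.dist_comm (u := y) (v := t)
    omega
  obtain ⟨t, ht, htd⟩ := hc.exists_adj_dist hxv
  have h1 := hl.dist_eq_of_forall_ne hc hxy hne ht
  have h5 := hc.dist_triangle (u := v) (v := t) (w := y)
  have := G.dist_comm (u := v) (v := x)
  have := G.dist_comm (u := v) (v := t)
  omega

/-- If the lines `v x` and `v y` are equal, then `v` is between `x` and `y`. -/
theorem LocallyConnected.dist_eq_of_line_eq (hl : G.LocallyConnected) (hc : G.Connected)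
    {v x y : V} (hxv : x ≠ v) (hyv : y ≠ v) (hxy : x ≠ y) (hL : G.line v x = G.line v y) :
    G.dist x y = G.dist v x + G.dist v y := by
  have h1 := hl.dist_ne_of_line_eq hc hxv hyv hxy hL
  have h2 := hl.dist_ne_of_line_eq hc hyv hxv hxy.symm hL.symm
  have h3 := (mem_line_iff (G := G) hxv.symm y).1 (hL ▸ right_mem_line v y)
  have := G.dist_comm (u := v) (v := x)
  have := G.dist_comm (u := v) (v := y)
  have := G.dist_comm (u := x) (v := y)
  omega

/-- If the lines `v x` and `v y` are equal, then every neighbour of `x` is closer to `y`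
than `x` is. -/
theorem LocallyConnected.dist_eq_add_one_of_line_eq (hl : G.LocallyConnected) (hc : G.Connected)
    {v x y : V} (hxv : x ≠ v) (hyv : y ≠ v) (hxy : x ≠ y) (hL : G.line v x = G.line v y)
    {t : V} (ht : G.Adj x t) : G.dist x y = G.dist t y + 1 := by
  refine hl.dist_eq_of_forall_ne hc hxy (fun t ht hty => ?_) ht
  have hd := hl.dist_eq_of_line_eq hc hxv hyv hxy hL
  have h1 := hc.mem_line_of_adj ht hxv.symm
  have h2 := mem_line_iff (G := G) hyv.symm t
  rw [hL] at h1
  have h3 := h1.symm.trans h2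
  have h4 := hc.adj_dist_le ht v
  have h5 := hc.dist_triangle (u := t) (v := v) (w := y)
  have h6 := hc.pos_dist_of_ne hyv
  have h7 := hc.pos_dist_of_ne hxv
  have := G.dist_comm (u := v) (v := x)
  have := G.dist_comm (u := v) (v := y)
  have := G.dist_comm (u := v) (v := t)
  have := G.dist_comm (u := y) (v := t)
  omega

/-- If the lines `v x` and `v y` are equal, then no shortest path from `y` extends beyond `x`. -/
theorem LocallyConnected.eq_of_dist_eq_add (hl : G.LocallyConnected) (hc : G.Connected)
    {v x y : V} (hxv : x ≠ v) (hyv : y ≠ v) (hxy : x ≠ y) (hL : G.line v x = G.line v y)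
    {w : V} (hw : G.dist y w = G.dist y x + G.dist x w) : w = x := by
  by_contra hne
  obtain ⟨t, ht, htd⟩ := hc.exists_adj_dist (Ne.symm hne)
  have h1 := hl.dist_eq_add_one_of_line_eq hc hxv hyv hxy hL ht
  have h2 := hc.dist_triangle (u := y) (v := t) (w := w)
  have := G.dist_comm (u := y) (v := x)
  have := G.dist_comm (u := y) (v := t)
  omega

/-- In a graph without false twins, if the lines `v x` and `v y` are equal, then no shortest path
from `v` extends beyond `x`. -/
theorem LocallyConnected.eq_of_dist_eq_add_center (hl : G.LocallyConnected) (hc : G.Connected)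
    (htf : Function.Injective G.neighborSet)
    {v x y : V} (hxv : x ≠ v) (hyv : y ≠ v) (hxy : x ≠ y) (hL : G.line v x = G.line v y)
    {w : V} (hw : G.dist v w = G.dist v x + G.dist x w) : w = x := by
  by_contra hne
  obtain ⟨t, ht, htd⟩ := hc.exists_adj_dist (Ne.symm hne)
  have hd := hl.dist_eq_of_line_eq hc hxv hyv hxy hL
  -- If `v a = v b` and a neighbour `s` of `a` lies beyond `a`, then `b` is a neighbour of `v`
  -- on a shortest path from `v` to `s`.
  have key : ∀ a b s : V, a ≠ v → b ≠ v → a ≠ b → G.line v a = G.line v b → G.Adj a s →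
      G.dist v s = G.dist v a + 1 → G.dist v b = 1 ∧ G.dist s b = G.dist v a := by
    intro a b s hav hbv hab hLab has hs
    have h1 := hl.dist_eq_add_one_of_line_eq hc hav hbv hab hLab has
    have h2 := hl.dist_eq_of_line_eq hc hav hbv hab hLab
    have h3 := hc.mem_line_of_adj has hav.symm
    have h4 := mem_line_iff (G := G) hbv.symm s
    rw [hLab] at h3
    have h5 := h3.symm.trans h4
    have h6 := hc.pos_dist_of_ne hbv
    have h7 := hc.pos_dist_of_ne hav
    have := G.dist_comm (u := v) (v := a)
    have := G.dist_comm (u := v) (v := b)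
    have := G.dist_comm (u := v) (v := s)
    have := G.dist_comm (u := b) (v := s)
    omega
  have hvt : G.dist v t = G.dist v x + 1 := by
    have h2 := hc.dist_triangle (u := v) (v := t) (w := w)
    have h3 := (hc.adj_dist_le ht v).2
    have := G.dist_comm (u := v) (v := x)
    have := G.dist_comm (u := v) (v := t)
    omega
  obtain ⟨h1, h2⟩ := key x y t hxv hyv hxy hL ht hvt
  have hyt : y ≠ t := by
    rintro rfl
    have := hc.pos_dist_of_ne hxv.symm
    simp at h2
    omega
  obtain ⟨s, hs, hsd⟩ := hc.exists_adj_dist hyt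
  have hvs : G.dist v s = G.dist v y + 1 := by
    have h4 := hc.dist_triangle (u := v) (v := s) (w := t)
    have h3 := (hc.adj_dist_le hs v).2
    have := G.dist_comm (u := v) (v := y)
    have := G.dist_comm (u := v) (v := s)
    have := G.dist_comm (u := y) (v := t)
    omega
  obtain ⟨h3, -⟩ := key y x s hyv hxv hxy.symm hL.symm hs hvs
  -- Both `x` and `y` are neighbours of `v`, at distance two, hence they are twins.
  refine hxy (htf (Set.ext fun r => ⟨fun hr => ?_, fun hr => ?_⟩))
  · have := hl.dist_eq_add_one_of_line_eq hc hxv hyv hxy hL hr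
    exact (dist_eq_one_iff_adj.1 (by omega : G.dist r y = 1)).symm
  · have := hl.dist_eq_add_one_of_line_eq hc hyv hxv hxy.symm hL.symm hr
    have := G.dist_comm (u := y) (v := x)
    exact (dist_eq_one_iff_adj.1 (by omega : G.dist r x = 1)).symm

/-- In a graph without false twins, two neighbours of `v` span different lines with `v`. -/
theorem LocallyConnected.line_ne_of_adj (hl : G.LocallyConnected) (hc : G.Connected)
    (htf : Function.Injective G.neighborSet) {v x y : V} (hx : G.Adj v x) (hy : G.Adj v y)
    (hxy : x ≠ y) : G.line v x ≠ G.line v y := by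
  intro hL
  have hd := hl.dist_eq_of_line_eq hc hx.ne' hy.ne' hxy hL
  rw [hx.dist_eq_one, hy.dist_eq_one] at hd
  refine hxy (htf (Set.ext fun r => ⟨fun hr => ?_, fun hr => ?_⟩))
  · have := hl.dist_eq_add_one_of_line_eq hc hx.ne' hy.ne' hxy hL hr
    exact (dist_eq_one_iff_adj.1 (by omega : G.dist r y = 1)).symm
  · have := hl.dist_eq_add_one_of_line_eq hc hy.ne' hx.ne' hxy.symm hL.symm hr
    have := G.dist_comm (u := y) (v := x)
    exact (dist_eq_one_iff_adj.1 (by omega : G.dist r x = 1)).symm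

/-! ### Pairs that generate a given line -/

open Classical in
/-- The vertices that generate the line `L` together with `p`. -/
noncomputable def partners [Fintype V] (G : SimpleGraph V) (L : Set V) (p : V) : Finset V :=
  {q | q ≠ p ∧ G.line p q = L}

section
variable [Fintype V]

theorem mem_partners {L : Set V} {p q : V} : q ∈ G.partners L p ↔ q ≠ p ∧ G.line p q = L := by
  simp [partners]

theorem mem_partners_comm {L : Set V} {p q : V} : q ∈ G.partners L p ↔ p ∈ G.partners L q := by
  rw [mem_partners, mem_partners, line_comm, ne_comm]

theorem mem_of_mem_partners {L : Set V} {p q : V} (h : q ∈ G.partners L p) : p ∈ L :=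
  (mem_partners.1 h).2 ▸ left_mem_line p q

theorem LocallyConnected.dist_partners (hl : G.LocallyConnected) (hc : G.Connected)
    {L : Set V} {v x y : V} (hx : x ∈ G.partners L v) (hy : y ∈ G.partners L v) (hxy : x ≠ y) :
    G.dist x y = G.dist v x + G.dist v y := by
  rw [mem_partners] at hx hy
  exact hl.dist_eq_of_line_eq hc hx.1 hy.1 hxy (hx.2.trans hy.2.symm)

theorem LocallyConnected.eq_of_beyond_partner (hl : G.LocallyConnected) (hc : G.Connected)
    (htf : Function.Injective G.neighborSet)
    {L : Set V} {v x y w : V} (hx : x ∈ G.partners L v) (hy : y ∈ G.partners L v) (hxy : x ≠ y)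
    (hw : G.dist v w = G.dist v x + G.dist x w) : w = x := by
  rw [mem_partners] at hx hy
  exact hl.eq_of_dist_eq_add_center hc htf hx.1 hy.1 hxy (hx.2.trans hy.2.symm) hw

/-- The pairs generating a line form a disjoint union of stars: a partner of a vertex with two
partners has no further partner. -/
theorem LocallyConnected.eq_of_mem_partners (hl : G.LocallyConnected) (hc : G.Connected)
    (htf : Function.Injective G.neighborSet)
    {L : Set V} {v x y w : V} (hx : x ∈ G.partners L v) (hy : y ∈ G.partners L v) (hxy : x ≠ y)
    (hw : w ∈ G.partners L x) : w = v := by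
  by_contra hne
  have h1 := hl.dist_partners hc hw (mem_partners_comm.1 hx) hne
  refine (mem_partners.1 hw).1 (hl.eq_of_beyond_partner hc htf hx hy hxy ?_)
  rw [dist_comm (u := v) (v := w), h1, dist_comm (u := v) (v := x), add_comm]

/-- If `x` is one of several partners of `v`, then a vertex `w ≠ v` of the line is between `v` and
`x`, or `v` is between `w` and `x`. -/
theorem LocallyConnected.dist_of_mem_of_partner (hl : G.LocallyConnected) (hc : G.Connected)
    (htf : Function.Injective G.neighborSet)
    {L : Set V} {v x y w : V} (hx : x ∈ G.partners L v) (hy : y ∈ G.partners L v) (hxy : x ≠ y)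
    (hw : w ∈ L) :
    G.dist v x = G.dist v w + G.dist w x ∨ G.dist w x = G.dist v w + G.dist v x := by
  have hx' := mem_partners.1 hx
  rw [← hx'.2, mem_line_iff hx'.1.symm] at hw
  rcases hw with h | h | h
  · exact .inl h
  · have := hl.eq_of_beyond_partner hc htf hx hy hxy h
    subst this
    simp
  · right
    rw [h, dist_comm (u := w) (v := v)]

/-- The stars of a line are far apart: if `v` and `v'` both have several partners, then `v` is
between `v'` and each partner of `v`. -/
theorem LocallyConnected.dist_partner_center (hl : G.LocallyConnected) (hc : G.Connected)
    (htf : Function.Injective G.neighborSet) {L : Set V} {v v' : V} (hvv : v ≠ v')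
    (hv : 1 < (G.partners L v).card) (hv' : 1 < (G.partners L v').card)
    {x : V} (hx : x ∈ G.partners L v) : G.dist v' x = G.dist v v' + G.dist v x := by
  obtain ⟨x', hx', hxx'⟩ := Finset.exists_mem_ne hv x
  obtain ⟨y1, hy1, y2, hy2, hy12⟩ := Finset.one_lt_card.1 hv'
  have hv'L : v' ∈ L := mem_of_mem_partners hy1
  have hvL : v ∈ L := mem_of_mem_partners hx
  refine (hl.dist_of_mem_of_partner hc htf hx hx' hxx'.symm hv'L).resolve_left fun h => ?_
  -- Some partner `y` of `v'` lies on the other side of `v'` than `v`.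
  obtain ⟨y, y', hy, hy', hyy, hd⟩ : ∃ y y', y ∈ G.partners L v' ∧ y' ∈ G.partners L v' ∧
      y ≠ y' ∧ G.dist v y = G.dist v' v + G.dist v' y := by
    rcases hl.dist_of_mem_of_partner hc htf hy1 hy2 hy12 hvL with h1 | h1
    · rcases hl.dist_of_mem_of_partner hc htf hy2 hy1 hy12.symm hvL with h2 | h2
      · have h3 := hl.dist_partners hc hy1 hy2 hy12
        have h4 := hc.dist_triangle (u := y1) (v := v) (w := y2)
        have := hc.pos_dist_of_ne hvv
        have := G.dist_comm (u := v) (v := v')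
        have := G.dist_comm (u := v) (v := y1)
        omega
      · exact ⟨y2, y1, hy2, hy1, hy12.symm, h2⟩
    · exact ⟨y1, y2, hy1, hy2, hy12, h1⟩
  have hyx : y ≠ x := by
    rintro rfl
    exact hvv (hl.eq_of_mem_partners hc htf hy hy' hyy (mem_partners_comm.1 hx))
  have h5 := G.dist_comm (u := v) (v := v')
  have h6 := G.dist_comm (u := v') (v := y)
  have h7 := hc.pos_dist_of_ne hvv
  rcases hl.dist_of_mem_of_partner hc htf hx hx' hxx'.symm (mem_of_mem_partners
    (mem_partners_comm.1 hy)) with h1 | h1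
  · exact hyx (hl.eq_of_beyond_partner hc htf hy hy' hyy (w := x) (by
      have := hc.dist_triangle (u := v') (v := y) (w := x)
      omega)).symm
  · have := hc.dist_triangle (u := y) (v := v') (w := x)
    omega

theorem LocallyConnected.dist_partner_partner (hl : G.LocallyConnected) (hc : G.Connected)
    (htf : Function.Injective G.neighborSet) {L : Set V} {v v' : V} (hvv : v ≠ v')
    (hv : 1 < (G.partners L v).card) (hv' : 1 < (G.partners L v').card)
    {x y : V} (hx : x ∈ G.partners L v) (hy : y ∈ G.partners L v') :
    G.dist x y = G.dist v x + G.dist v v' + G.dist v' y := by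
  have h1 := hl.dist_partner_center hc htf hvv hv hv' hx
  have h2 := hl.dist_partner_center hc htf hvv.symm hv' hv hy
  obtain ⟨y', hy', hyy'⟩ := Finset.exists_mem_ne hv' y
  have h3 := hc.pos_dist_of_ne hvv
  have h4 := G.dist_comm (u := v) (v := v')
  have h5 := G.dist_comm (u := v') (v := x)
  rcases hl.dist_of_mem_of_partner hc htf hy hy' hyy'.symm (mem_of_mem_partners
    (mem_partners_comm.1 hx)) with h | h
  · have := hc.dist_triangle (u := v) (v := x) (w := y)
    omega
  · omega

/-! ### A line of a twin-free graph is generated by at most `n / 2` pairs -/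

/-- A vertex `v` with two partners `x`, `y` has adjacent neighbours `a`, `u` such that `a` is
closer to `x` than `v` is and `u` is off the line. -/
theorem LocallyConnected.exists_adj_off_line (hl : G.LocallyConnected) (hc : G.Connected)
    {L : Set V} {v x y : V} (hx : x ∈ G.partners L v) (hy : y ∈ G.partners L v) (hxy : x ≠ y) :
    ∃ a u, G.Adj v a ∧ G.Adj v u ∧ G.Adj a u ∧ G.dist v x = G.dist a x + 1 ∧
      G.dist u x = G.dist v x ∧ u ∉ L := by
  have hd := hl.dist_partners hc hx hy hxy
  rw [mem_partners] at hx hy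
  obtain ⟨s, hs, hsd⟩ := hc.exists_adj_dist hx.1.symm
  obtain ⟨t, ht, htd⟩ := hc.exists_adj_dist hy.1.symm
  obtain ⟨a, u, ha, hu, hau, h1, h2⟩ := hl.exists_adj_of_mem_of_not_mem
    {r | G.dist v x = G.dist r x + 1} hs ht hsd (fun h => by
      simp only [Set.mem_ofPred_eq] at h
      have := hc.dist_triangle (u := x) (v := t) (w := y)
      have := G.dist_comm (u := x) (v := t)
      omega)
  simp only [Set.mem_ofPred_eq] at h1 h2
  have h3 := (hc.adj_dist_le hau x)
  have h4 := (hc.adj_dist_le hu x)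
  have h5 : G.dist u x = G.dist v x := by omega
  refine ⟨a, u, ha, hu, hau, h1, h5, fun h => ?_⟩
  rw [← hx.2, line_comm, hc.mem_line_of_adj hu hx.1] at h
  exact h h5

/-- The neighbours off the line of two centres of stars are different. -/
theorem LocallyConnected.not_adj_of_not_mem (hl : G.LocallyConnected) (hc : G.Connected)
    (htf : Function.Injective G.neighborSet) {L : Set V} {v v' : V} (hvv : v ≠ v')
    (hv : 1 < (G.partners L v).card) (hv' : 1 < (G.partners L v').card)
    {u : V} (hu : u ∉ L) (huv : G.Adj v u) : ¬ G.Adj v' u := by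
  intro huv'
  obtain ⟨x, hx⟩ := Finset.card_pos.1 (zero_lt_one.trans hv)
  obtain ⟨y, hy⟩ := Finset.card_pos.1 (zero_lt_one.trans hv')
  have h1 := hl.dist_partner_partner hc htf hvv hv hv' hx hy
  rw [mem_partners] at hx hy
  have h2 : G.dist u x = G.dist v x := by
    by_contra h
    rw [← hx.2, line_comm, hc.mem_line_of_adj huv hx.1] at hu
    exact hu h
  have h3 : G.dist u y = G.dist v' y := by
    by_contra h
    rw [← hy.2, line_comm, hc.mem_line_of_adj huv' hy.1] at hu
    exact hu h
  have := hc.dist_triangle (u := x) (v := u) (w := y)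
  have := G.dist_comm (u := x) (v := u)
  have := hc.pos_dist_of_ne hvv
  omega

/-- If `v` has at least three partners, and one of them, `x`, is not adjacent to `v`, then some
neighbour `a` of `v` on a shortest path to `x` has no partner at all. -/
theorem LocallyConnected.exists_adj_without_partner (hl : G.LocallyConnected) (hc : G.Connected)
    (htf : Function.Injective G.neighborSet) {L : Set V} {v x : V}
    (hv : 2 < (G.partners L v).card) (hx : x ∈ G.partners L v) (hvx : 1 < G.dist v x) :
    ∃ a, G.Adj v a ∧ G.dist v x = G.dist a x + 1 ∧ G.partners L a = ∅ := by
  classical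
  -- Two further partners `y` and `z` of `v`.
  obtain ⟨y, z, hy, hz, hxy, hxz, hyz⟩ : ∃ y z, y ∈ G.partners L v ∧ z ∈ G.partners L v ∧
      x ≠ y ∧ x ≠ z ∧ y ≠ z := by
    have h1 : 1 < ((G.partners L v).erase x).card := by
      rw [Finset.card_erase_of_mem hx]; omega
    obtain ⟨y, hy, z, hz, hyz⟩ := Finset.one_lt_card.1 h1
    rw [Finset.mem_erase] at hy hz
    exact ⟨y, z, hy.2, hz.2, hy.1.symm, hz.1.symm, hyz⟩
  obtain ⟨a, u, ha, hu, hau, hax, hux, huL⟩ := hl.exists_adj_off_line hc hx hy hxy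
  refine ⟨a, ha, hax, Finset.eq_empty_of_forall_notMem fun w hw => ?_⟩
  have hva := ha.dist_eq_one
  have hav := ha.symm.dist_eq_one
  have hwa := (mem_partners.1 hw).1
  have hwL : w ∈ L := mem_of_mem_partners (mem_partners_comm.1 hw)
  have hvL : v ∈ L := mem_of_mem_partners hx
  -- The other partners of `v` are reached from `a` through `v`.
  have hfar : ∀ y ∈ G.partners L v, x ≠ y → G.dist a y = G.dist v y + 1 := by
    intro y hy hxy
    have h1 := hl.dist_partners hc hx hy hxy
    have h2 := hc.dist_triangle (u := x) (v := a) (w := y)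
    have := G.dist_comm (u := x) (v := a)
    have := (hc.adj_dist_le ha y)
    omega
  have hwv : w ≠ v := by
    rintro rfl
    have hxa : x ≠ a := by
      rintro rfl
      simp at hax; omega
    have := hl.dist_partners hc hx (mem_partners_comm.1 hw) hxa
    have := G.dist_comm (u := x) (v := a)
    omega
  have hwpos := hc.pos_dist_of_ne hwv
  have hwapos := hc.pos_dist_of_ne hwa
  have c1 := G.dist_comm (u := w) (v := v)
  have c2 := G.dist_comm (u := w) (v := a)
  -- If `v` is between `w` and a partner other than `x`, then `a` is between `v` and `w`.
  have hvw : ∀ y z, y ∈ G.partners L v → z ∈ G.partners L v → y ≠ z → x ≠ y →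
      G.dist w y = G.dist v w + G.dist v y → G.dist v w = G.dist a w + 1 := by
    intro y z hy hz hyz hxy h1
    have h2 := hfar y hy hxy
    have h3 : y ∈ G.line a w := by
      rw [(mem_partners.1 hw).2]
      exact mem_of_mem_partners (mem_partners_comm.1 hy)
    rw [mem_line_iff hwa.symm] at h3
    have := hc.pos_dist_of_ne (mem_partners.1 hy).1
    have := hc.adj_dist_le ha w
    have := G.dist_comm (u := y) (v := w)
    have := G.dist_comm (u := y) (v := v)
    have := G.dist_comm (u := y) (v := a)
    omega
  have hw1 : G.dist v w = G.dist a w + 1 := by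
    rcases hl.dist_of_mem_of_partner hc htf hy hz hyz hwL with h1 | h1
    · rcases hl.dist_of_mem_of_partner hc htf hz hy hyz.symm hwL with h2 | h2
      · have h3 := hl.dist_partners hc hy hz hyz
        have h4 := hc.dist_triangle (u := y) (v := w) (w := z)
        have := G.dist_comm (u := y) (v := w)
        omega
      · exact hvw z y hz hy hyz.symm hxz h2
    · exact hvw y z hy hz hyz hxy h1
  have hw2 : G.dist v x = G.dist v w + G.dist w x := by
    refine (hl.dist_of_mem_of_partner hc htf hx hy hxy hwL).resolve_right fun h => ?_
    have := hc.dist_triangle (u := w) (v := a) (w := x)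
    omega
  -- Hence `a` is between `u` and `w`, so that `u` would be on the line.
  refine huL ?_
  rw [← (mem_partners.1 hw).2, mem_line_iff hwa.symm]
  have h1 := hc.dist_triangle (u := u) (v := w) (w := x)
  have h2 := hc.dist_triangle (u := u) (v := a) (w := w)
  have h3 := hau.dist_eq_one
  have h4 := hau.symm.dist_eq_one
  omega

/-- A set of vertices reserved for `p`, at least as large as the number of partners of `p`. The
three kinds of members are chosen so that the sets reserved for different vertices are disjoint. -/
theorem LocallyConnected.exists_reserved (hl : G.LocallyConnected) (hc : G.Connected)
    (htf : Function.Injective G.neighborSet) (L : Set V) (p : V) :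
    ∃ s : Finset V, (G.partners L p).card ≤ s.card ∧ ∀ z ∈ s,
      (z = p ∧ (G.partners L p).Nonempty) ∨
      (1 < (G.partners L p).card ∧ G.Adj p z ∧ z ∉ L) ∨
      (1 < (G.partners L p).card ∧ G.Adj p z ∧ G.partners L z = ∅ ∧
        ∃ x ∈ G.partners L p, G.dist p x = G.dist z x + 1) := by
  classical
  rcases lt_trichotomy (G.partners L p).card 2 with hd | hd | hd
  · rcases (G.partners L p).eq_empty_or_nonempty with he | hne
    · exact ⟨∅, by simp [he], by simp⟩
    · exact ⟨{p}, by rw [Finset.card_singleton]; omega, by simpa using hne⟩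
  · obtain ⟨x, hx, y, hy, hxy⟩ := Finset.one_lt_card.1 (show 1 < (G.partners L p).card by omega)
    obtain ⟨a, u, -, hu, -, -, -, huL⟩ := hl.exists_adj_off_line hc hx hy hxy
    refine ⟨{p, u}, by rw [Finset.card_pair hu.ne, hd], fun z hz => ?_⟩
    rcases Finset.mem_insert.1 hz with rfl | hz
    · exact .inl ⟨rfl, x, hx⟩
    · rw [Finset.mem_singleton] at hz
      subst hz
      exact .inr (.inl ⟨by omega, hu, huL⟩)
  · choose! a ha using fun x (hx : x ∈ G.partners L p ∧ 1 < G.dist p x) =>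
      hl.exists_adj_without_partner hc htf hd hx.1 hx.2
    let F := (G.partners L p).filter fun x => 1 < G.dist p x
    have hF : ∀ x ∈ F, x ∈ G.partners L p ∧ 1 < G.dist p x := fun x hx => Finset.mem_filter.1 hx
    refine ⟨insert p (F.image a), ?_, fun z hz => ?_⟩
    · have hpF : p ∉ F.image a := by
        intro h
        obtain ⟨x, hx, hxp⟩ := Finset.mem_image.1 h
        exact (ha x (hF x hx)).1.ne' hxp
      have hinj : Set.InjOn a F := by
        intro x hx y hy hxy
        by_contra hne
        have h1 := hl.dist_partners hc (hF x hx).1 (hF y hy).1 hne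
        have h2 := (ha x (hF x hx)).2.1
        have h3 := (ha y (hF y hy)).2.1
        have h4 := hc.dist_triangle (u := x) (v := a x) (w := y)
        have := G.dist_comm (u := x) (v := a x)
        rw [hxy] at this h2 h4
        omega
      rw [Finset.card_insert_of_notMem hpF, Finset.card_image_of_injOn hinj,
        ← Finset.card_filter_add_card_filter_not (s := G.partners L p) fun x => 1 < G.dist p x,
        add_le_add_iff_left, Finset.card_le_one]
      -- At most one partner is adjacent to `p`.
      have hadj : ∀ x ∈ (G.partners L p).filter (fun x => ¬ 1 < G.dist p x), G.Adj p x := by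
        intro x hx
        rw [Finset.mem_filter] at hx
        have := hc.pos_dist_of_ne (mem_partners.1 hx.1).1.symm
        exact dist_eq_one_iff_adj.1 (by omega)
      intro x hx y hy
      by_contra hne
      refine hl.line_ne_of_adj hc htf (hadj x hx) (hadj y hy) hne ?_
      rw [(mem_partners.1 (Finset.mem_filter.1 hx).1).2,
        (mem_partners.1 (Finset.mem_filter.1 hy).1).2]
    · rcases Finset.mem_insert.1 hz with rfl | hz
      · exact .inl ⟨rfl, Finset.card_pos.1 (by omega)⟩
      · obtain ⟨x, hx, rfl⟩ := Finset.mem_image.1 hz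
        have h := ha x (hF x hx)
        exact .inr (.inr ⟨by omega, h.1, h.2.2, x, (hF x hx).1, h.2.1⟩)

/-- In a graph without false twins on `n` vertices, a line is generated by at most `n / 2` pairs. -/
theorem LocallyConnected.sum_card_partners_le (hl : G.LocallyConnected) (hc : G.Connected)
    (htf : Function.Injective G.neighborSet) (L : Set V) :
    ∑ p, (G.partners L p).card ≤ Fintype.card V := by
  classical
  choose s hs hsz using hl.exists_reserved hc htf L
  have hdisj : (↑(Finset.univ : Finset V) : Set V).PairwiseDisjoint s := by
    rintro p - q - hpq
    refine Finset.disjoint_left.2 fun z hzp hzq => ?_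
    have hL : ∀ {p}, (∃ x ∈ G.partners L p, G.dist p x = G.dist z x + 1) → G.Adj p z → z ∈ L := by
      rintro p ⟨x, hx, hd⟩ h
      rw [← (mem_partners.1 hx).2, line_comm, hc.mem_line_of_adj h (mem_partners.1 hx).1]
      omega
    have hnil : ∀ {p}, (G.partners L p).Nonempty → p ∈ L := fun ⟨x, hx⟩ => mem_of_mem_partners hx
    rcases hsz p z hzp with ⟨rfl, h1⟩ | ⟨h1, h2, h3⟩ | ⟨h1, h2, h3, h4⟩ <;>
    rcases hsz q z hzq with ⟨h0, h5⟩ | ⟨h5, h6, h7⟩ | ⟨h5, h6, h7, h8⟩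
    · exact hpq h0
    · exact h7 (hnil h1)
    · exact h1.ne_empty h7
    · exact h3 (h0 ▸ hnil h5)
    · exact hl.not_adj_of_not_mem hc htf hpq h1 h5 h3 h2 h6
    · exact h3 (hL h8 h6)
    · exact h5.ne_empty (h0 ▸ h3)
    · exact h7 (hL h4 h2)
    · obtain ⟨x, hx, hd⟩ := h4
      have h9 := hl.dist_partner_center hc htf hpq h1 h5 hx
      have h10 := (hc.adj_dist_le h6 x).1
      have := hc.pos_dist_of_ne hpq
      omega
  calc ∑ p, (G.partners L p).card ≤ ∑ p, (s p).card := Finset.sum_le_sum fun p _ => hs p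
    _ = (Finset.univ.biUnion s).card := (Finset.card_biUnion hdisj).symm
    _ ≤ Fintype.card V := Finset.card_le_univ _

end

/-- If the lines `v x` and `v y` are equal, then every vertex of the line `x y` is between `x`
and `y`. -/
theorem LocallyConnected.dist_add_dist_of_mem_line (hl : G.LocallyConnected) (hc : G.Connected)
    {v x y : V} (hxv : x ≠ v) (hyv : y ≠ v) (hxy : x ≠ y) (hL : G.line v x = G.line v y)
    {c : V} (h : c ∈ G.line x y) : G.dist x y = G.dist x c + G.dist c y := by
  rcases (mem_line_iff hxy c).1 h with h | h | h
  · exact h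
  · obtain rfl := hl.eq_of_dist_eq_add hc hyv hxv hxy.symm hL.symm h
    simp
  · obtain rfl := hl.eq_of_dist_eq_add hc hxv hyv hxy hL (w := c) (by
      rw [dist_comm (u := y), dist_comm (u := y), h, add_comm, dist_comm (u := c)])
    simp

/-- Let the lines `v x` and `v y` be equal, and let the pair `w z` generate the line `x y`. Then
either `x`, `y`, `w`, `z` are on a common shortest path from `x` to `y` or the distances from `w`
to `z` and from `x` to `y` are equal. -/
theorem LocallyConnected.dist_of_line_eq_interval (hl : G.LocallyConnected) (hc : G.Connected)
    {v x y w z : V} (hxv : x ≠ v) (hyv : y ≠ v) (hxy : x ≠ y) (hL : G.line v x = G.line v y)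
    (hwz : w ≠ z) (hS : G.line w z = G.line x y) :
    w ≠ x ∧ w ≠ y ∧
    (G.dist w y = G.dist w z + G.dist z y ∧ G.dist x z = G.dist x w + G.dist w z ∨
     G.dist w x = G.dist w z + G.dist z x ∧ G.dist y z = G.dist y w + G.dist w z ∨
     G.dist w z = G.dist x y ∧ G.dist w z = G.dist w x + G.dist x z) ∨
    (w = x ∧ z = y) ∨ (w = y ∧ z = x) := by
  have hw := hl.dist_add_dist_of_mem_line hc hxv hyv hxy hL (hS ▸ left_mem_line w z)
  have hz := hl.dist_add_dist_of_mem_line hc hxv hyv hxy hL (hS ▸ right_mem_line w z)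
  have c1 := G.dist_comm (u := x) (v := y)
  have c2 := G.dist_comm (u := w) (v := z)
  have c3 := G.dist_comm (u := x) (v := w)
  have c4 := G.dist_comm (u := x) (v := z)
  have c5 := G.dist_comm (u := y) (v := w)
  have c6 := G.dist_comm (u := y) (v := z)
  by_cases hwx : w = x
  · subst hwx
    by_cases hzy : z = y
    · exact .inr (.inl ⟨rfl, hzy⟩)
    · have := hl.dist_eq_of_line_eq hc hwz.symm hxy.symm hzy hS
      have := hc.pos_dist_of_ne hwz
      omega
  by_cases hwy : w = y
  · subst hwy
    by_cases hzx : z = x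
    · exact .inr (.inr ⟨rfl, hzx⟩)
    · have := hl.dist_eq_of_line_eq hc hwz.symm hxy hzx (hS.trans (line_comm _ _))
      have := hc.pos_dist_of_ne hwz
      omega
  refine .inl ⟨hwx, hwy, ?_⟩
  have hx : x ∈ G.line w z := hS ▸ left_mem_line x y
  have hy : y ∈ G.line w z := hS ▸ right_mem_line x y
  rw [mem_line_iff hwz] at hx hy
  have := hc.pos_dist_of_ne hwx
  have := hc.pos_dist_of_ne hwy
  have := hc.pos_dist_of_ne hwz
  omega

section
variable [Fintype V]

/-- If the lines `v x` and `v y` are equal, then `v` together with another vertex never generates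
the line `x y`. -/
theorem LocallyConnected.partners_line_eq_empty (hl : G.LocallyConnected) (hc : G.Connected)
    (htf : Function.Injective G.neighborSet)
    {v x y : V} (hxv : x ≠ v) (hyv : y ≠ v) (hxy : x ≠ y) (hL : G.line v x = G.line v y) :
    G.partners (G.line x y) v = ∅ := by
  refine Finset.eq_empty_of_forall_notMem fun z hz => ?_
  obtain ⟨hzv, hS⟩ := mem_partners.1 hz
  -- `z` is not between `v` and either end of the interval from `x` to `y`.
  have key : ∀ x y, x ≠ v → y ≠ v → x ≠ y → G.line v x = G.line v y →
      G.line v z = G.line x y → G.dist v y = G.dist v z + G.dist z y →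
      G.dist x z = G.dist x v + G.dist v z → False := by
    intro x y hxv hyv hxy hL hS h1 h2
    have hd := hl.dist_eq_of_line_eq hc hxv hyv hxy hL
    have hne : ∀ t, G.Adj v t → G.dist t z ≠ G.dist v z := by
      intro t ht htz
      have h3 := hc.mem_line_of_adj ht hzv
      have h4 := hc.mem_line_of_adj ht hxv
      have h5 := hc.mem_line_of_adj ht hyv
      rw [line_comm, hS, mem_line_iff hxy] at h3
      rw [line_comm, hL, line_comm] at h4
      have h6 := h4.symm.trans h5
      have := hc.adj_dist_le ht x
      have := hc.adj_dist_le ht y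
      have := hc.dist_triangle (u := t) (v := z) (w := y)
      have := hc.dist_triangle (u := x) (v := t) (w := y)
      have := G.dist_comm (u := t) (v := x)
      have := G.dist_comm (u := t) (v := y)
      have := G.dist_comm (u := v) (v := x)
      have := G.dist_comm (u := v) (v := y)
      omega
    obtain ⟨t, ht, htd⟩ := hc.exists_adj_dist hxv.symm
    have h3 := hl.dist_eq_of_forall_ne hc hzv.symm hne ht
    have := hc.dist_triangle (u := x) (v := t) (w := z)
    have := G.dist_comm (u := t) (v := x)
    have := G.dist_comm (u := v) (v := x)
    omega
  have hd := hl.dist_eq_of_line_eq hc hxv hyv hxy hL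
  rcases hl.dist_of_line_eq_interval hc hxv hyv hxy hL hzv.symm hS with
    ⟨-, -, h | h | h⟩ | h | h
  · exact key x y hxv hyv hxy hL hS h.1 h.2
  · exact key y x hyv hxv hxy.symm hL.symm (hS.trans (line_comm _ _)) h.1 h.2
  · obtain rfl := hl.eq_of_dist_eq_add_center hc htf hxv hyv hxy hL h.2
    have := hc.pos_dist_of_ne hyv
    have := G.dist_comm (u := v) (v := y)
    omega
  · exact hxv h.1.symm
  · exact hyv h.1.symm

/-- If the lines `v x` and `v y` are equal, then the pairs generating the line `x y` are pairwise
disjoint. -/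
theorem LocallyConnected.card_partners_line_le_one (hl : G.LocallyConnected) (hc : G.Connected)
    (htf : Function.Injective G.neighborSet)
    {v x y : V} (hxv : x ≠ v) (hyv : y ≠ v) (hxy : x ≠ y) (hL : G.line v x = G.line v y) (w : V) :
    (G.partners (G.line x y) w).card ≤ 1 := by
  refine Finset.card_le_one.2 fun z hz z' hz' => ?_
  by_contra hne
  have hd := hl.dist_partners hc hz hz' hne
  have hbz : ∀ c, G.dist w c = G.dist w z + G.dist z c → c = z := fun c =>
    hl.eq_of_beyond_partner hc htf hz hz' hne
  have hI : ∀ z, z ∈ G.partners (G.line x y) w → G.dist x y = G.dist x z + G.dist z y :=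
    fun z hz => hl.dist_add_dist_of_mem_line hc hxv hyv hxy hL
      (mem_of_mem_partners (mem_partners_comm.1 hz))
  have h1 := hI z hz
  have h2 := hI z' hz'
  rw [mem_partners] at hz hz'
  have h3 := hc.dist_triangle (u := z) (v := x) (w := z')
  have h4 := hc.dist_triangle (u := z) (v := y) (w := z')
  have h5 := hc.pos_dist_of_ne hz'.1
  have c1 := G.dist_comm (u := x) (v := z)
  have c2 := G.dist_comm (u := y) (v := z')
  have c3 := G.dist_comm (u := w) (v := z')
  have hzw := hl.dist_of_line_eq_interval hc hxv hyv hxy hL hz.1 ((line_comm _ _).trans hz.2)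
  have hwz' := hl.dist_of_line_eq_interval hc hxv hyv hxy hL hz'.1.symm hz'.2
  rcases hl.dist_of_line_eq_interval hc hxv hyv hxy hL hz.1.symm hz.2 with
    ⟨hwx, hwy, h | h | h⟩ | ⟨rfl, rfl⟩ | ⟨rfl, rfl⟩
  · obtain rfl := hbz y h.1
    tauto
  · obtain rfl := hbz x h.1
    tauto
  · omega
  · rcases hwz' with h | h | h
    · exact h.1 rfl
    · exact hne h.2.symm
    · exact hxy h.1
  · rcases hwz' with h | h | h
    · exact h.2.1 rfl
    · exact hxy h.1.symm
    · exact hne h.2.symm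

/-- In a locally connected connected graph with at least three vertices, every edge is in a
triangle. -/
theorem LocallyConnected.exists_triangle (hl : G.LocallyConnected) (hc : G.Connected)
    (hn : 3 ≤ Fintype.card V) {a b : V} (hab : G.Adj a b) : ∃ c, G.Adj a c ∧ G.Adj b c := by
  classical
  -- A second neighbour of `a` gives an edge from `b` to a common neighbour.
  have key : ∀ {a b s}, G.Adj a b → G.Adj a s → s ≠ b → ∃ c, G.Adj a c ∧ G.Adj b c := by
    intro a b s hab has hsb
    obtain ⟨b', c, -, hc, hbc, hb', -⟩ := hl.exists_adj_of_mem_of_not_mem {b} hab has rfl hsb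
    rw [Set.mem_singleton_iff] at hb'
    exact ⟨c, hc, hb' ▸ hbc⟩
  by_contra hno
  have ha : ∀ s, G.Adj a s → s = b := fun s hs => by
    by_contra h
    exact hno (key hab hs h)
  have hb : ∀ s, G.Adj b s → s = a := fun s hs => by
    by_contra h
    obtain ⟨c, h1, h2⟩ := key hab.symm hs h
    exact hno ⟨c, h2, h1⟩
  obtain ⟨c, hca, hcb⟩ : ∃ c, c ≠ a ∧ c ≠ b := by
    by_contra! h
    have h1 : (Finset.univ : Finset V) ⊆ {a, b} := fun c _ => by
      by_cases hca : c = a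
      · simp [hca]
      · simp [h c hca]
    have h2 := Finset.card_le_card h1
    have h3 : ({a, b} : Finset V).card ≤ 2 := Finset.card_le_two
    rw [Finset.card_univ] at h2
    omega
  obtain ⟨s, hs, hsd⟩ := hc.exists_adj_dist hca.symm
  obtain ⟨t, ht, htd⟩ := hc.exists_adj_dist hcb.symm
  rw [ha s hs] at hsd
  rw [hb t ht] at htd
  omega

/-- Some line is generated by fewer than `n / 2` pairs: if `v` is between `x` and `y` and the lines
`v x` and `v y` are equal, then this is the line `x y`, and if no such triple exists, then it is
the line of any edge. -/
theorem LocallyConnected.exists_sum_card_partners_lt (hl : G.LocallyConnected) (hc : G.Connected)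
    (htf : Function.Injective G.neighborSet) (hn : 3 ≤ Fintype.card V) :
    ∃ a b : V, a ≠ b ∧ ∑ p, (G.partners (G.line a b) p).card < Fintype.card V := by
  have key : ∀ (L : Set V) (v : V), (∀ p, (G.partners L p).card ≤ 1) → G.partners L v = ∅ →
      ∑ p, (G.partners L p).card < Fintype.card V := by
    intro L v h1 h2
    calc ∑ p, (G.partners L p).card < ∑ _p : V, 1 :=
          Finset.sum_lt_sum (fun p _ => h1 p) ⟨v, Finset.mem_univ v, by simp [h2]⟩
      _ = Fintype.card V := by simp
  by_cases hbad : ∃ v x y, x ≠ v ∧ y ≠ v ∧ x ≠ y ∧ G.line v x = G.line v y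
  · obtain ⟨v, x, y, hxv, hyv, hxy, hL⟩ := hbad
    exact ⟨x, y, hxy, key _ v (hl.card_partners_line_le_one hc htf hxv hyv hxy hL)
      (hl.partners_line_eq_empty hc htf hxv hyv hxy hL)⟩
  · obtain ⟨v⟩ := hc.nonempty
    obtain ⟨⟨b, hb⟩⟩ := (hl v).nonempty
    obtain ⟨c, h1, h2⟩ := hl.exists_triangle hc hn hb
    refine ⟨v, b, hb.ne, key _ c (fun p => ?_) ?_⟩
    · refine Finset.card_le_one.2 fun z hz z' hz' => ?_
      rw [mem_partners] at hz hz'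
      by_contra hne
      exact hbad ⟨p, z, z', hz.1, hz'.1, hne, hz.2.trans hz'.2.symm⟩
    · refine Finset.eq_empty_of_forall_notMem fun z hz => ?_
      have h3 := mem_of_mem_partners hz
      rw [hc.mem_line_adj hb, h1.dist_eq_one, h2.dist_eq_one] at h3
      exact h3 rfl

/-- A connected, locally connected graph without false twins on at least three vertices has at
least as many lines as vertices: its `n * (n - 1)` ordered pairs are distributed over the lines,
at most `n` to each line and fewer than `n` to one of them. -/
theorem LocallyConnected.card_le_ncard_lines_of_injective (hl : G.LocallyConnected)
    (hc : G.Connected) (htf : Function.Injective G.neighborSet) (hn : 3 ≤ Fintype.card V) :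
    Fintype.card V ≤ G.lines.ncard := by
  classical
  have hfin : G.lines.Finite := Set.toFinite _
  rw [Set.ncard_eq_toFinset_card _ hfin]
  obtain ⟨a, b, hab, hlt⟩ := hl.exists_sum_card_partners_lt hc htf hn
  have hsum : ∑ L ∈ hfin.toFinset, ∑ p, (G.partners L p).card =
      Fintype.card V * (Fintype.card V - 1) := by
    rw [Finset.sum_comm]
    have h : ∀ p : V, ∑ L ∈ hfin.toFinset, (G.partners L p).card = Fintype.card V - 1 := by
      intro p
      rw [← Finset.card_univ, ← Finset.card_erase_of_mem (Finset.mem_univ p),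
        Finset.card_eq_sum_card_fiberwise (f := fun q => G.line p q) (t := hfin.toFinset)]
      · refine Finset.sum_congr rfl fun L _ => congrArg Finset.card (Finset.ext fun q => ?_)
        rw [mem_partners]
        simp
      · intro q hq
        rw [Finset.mem_coe, Set.Finite.mem_toFinset]
        exact ⟨p, q, (Finset.ne_of_mem_erase hq).symm, rfl⟩
    rw [Finset.sum_congr rfl fun p _ => h p]
    simp
  have hlt' : ∑ L ∈ hfin.toFinset, ∑ p, (G.partners L p).card <
      ∑ _L ∈ hfin.toFinset, Fintype.card V :=
    Finset.sum_lt_sum (fun L _ => hl.sum_card_partners_le hc htf L)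
      ⟨G.line a b, hfin.mem_toFinset.2 ⟨a, b, hab, rfl⟩, hlt⟩
  rw [hsum, Finset.sum_const, smul_eq_mul, mul_comm] at hlt'
  have := lt_of_mul_lt_mul_right hlt' (Nat.zero_le _)
  omega

end

/-! ### Removing a false twin -/

/-- Homomorphisms of connected graphs do not increase distances. -/
theorem Connected.dist_map_le {W : Type*} {H : SimpleGraph W} (hc : G.Connected) (f : G →g H)
    (a b : V) : H.dist (f a) (f b) ≤ G.dist a b := by
  obtain ⟨p, hp⟩ := hc.exists_walk_length_eq_dist a b
  rw [← hp, ← Walk.length_map f p]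
  exact dist_le _

/-- The graph obtained by removing the vertex `z`. -/
abbrev removed (G : SimpleGraph V) (z : V) : SimpleGraph {y // y ≠ z} :=
  G.comap Subtype.val

open Classical in
/-- If `x` and `z` are false twins, then mapping `z` to `x` retracts `G` onto `G - z`. -/
noncomputable def twinRetraction {x z : V} (hxz : x ≠ z)
    (hN : G.neighborSet x = G.neighborSet z) : G →g G.removed z where
  toFun y := if h : y = z then ⟨x, hxz⟩ else ⟨y, h⟩
  map_rel' := by
    have hN' : ∀ y, G.Adj x y ↔ G.Adj z y := fun y => Set.ext_iff.1 hN y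
    intro a b hab
    change G.Adj _ _
    by_cases ha : a = z <;> by_cases hb : b = z
    · subst ha hb
      exact absurd hab (G.loopless.irrefl _)
    · subst ha
      simpa [hb] using (hN' b).2 hab
    · subst hb
      simpa [ha] using ((hN' a).2 hab.symm).symm
    · simpa [ha, hb] using hab

theorem twinRetraction_coe {x z : V} (hxz : x ≠ z)
    (hN : G.neighborSet x = G.neighborSet z) (y : {y // y ≠ z}) :
    twinRetraction hxz hN y = y :=
  dif_neg y.2

theorem Connected.removed (hc : G.Connected) {x z : V} (hxz : x ≠ z)
    (hN : G.neighborSet x = G.neighborSet z) : (G.removed z).Connected :=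
  hc.map (twinRetraction hxz hN) fun y => ⟨y, twinRetraction_coe hxz hN y⟩

theorem Connected.dist_removed (hc : G.Connected) {x z : V} (hxz : x ≠ z)
    (hN : G.neighborSet x = G.neighborSet z) (a b : {y // y ≠ z}) :
    (G.removed z).dist a b = G.dist a b := by
  apply le_antisymm
  · have h := hc.dist_map_le (twinRetraction hxz hN) a b
    rwa [twinRetraction_coe, twinRetraction_coe] at h
  · exact (hc.removed hxz hN).dist_map_le ⟨Subtype.val, fun h => h⟩ a b

theorem LocallyConnected.removed (hl : G.LocallyConnected) {x z : V} (hxz : x ≠ z)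
    (hN : G.neighborSet x = G.neighborSet z) : (G.removed z).LocallyConnected := by
  intro v
  let f : G.induce (G.neighborSet v) →g (G.removed z).induce ((G.removed z).neighborSet v) :=
    { toFun := fun y => ⟨twinRetraction hxz hN y, by
        have h := (twinRetraction hxz hN).map_rel y.2
        rwa [twinRetraction_coe] at h⟩
      map_rel' := fun {a b} hab => (twinRetraction hxz hN).map_rel hab }
  refine (hl v).map f fun y => ⟨⟨y, y.2⟩, Subtype.ext ?_⟩
  exact twinRetraction_coe hxz hN y

theorem Connected.mem_line_removed (hc : G.Connected) {x z : V} (hxz : x ≠ z)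
    (hN : G.neighborSet x = G.neighborSet z) {a b : {y // y ≠ z}} (hab : a ≠ b)
    (c : {y // y ≠ z}) : c ∈ (G.removed z).line a b ↔ (c : V) ∈ G.line a b := by
  rw [mem_line_iff hab, mem_line_iff (fun h => hab (Subtype.ext h))]
  simp only [hc.dist_removed hxz hN]

/-- False twins are equidistant from every other vertex. -/
theorem Connected.dist_eq_of_neighborSet_eq (hc : G.Connected) {x z : V}
    (hN : G.neighborSet x = G.neighborSet z) {c : V} (hcx : c ≠ x) (hcz : c ≠ z) :
    G.dist x c = G.dist z c := by
  obtain ⟨t, ht, htd⟩ := hc.exists_adj_dist hcx.symm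
  obtain ⟨s, hs, hsd⟩ := hc.exists_adj_dist hcz.symm
  have h1 : G.Adj z t := (Set.ext_iff.1 hN t).1 ht
  have h2 : G.Adj x s := (Set.ext_iff.1 hN s).2 hs
  have := (hc.adj_dist_le h1 c).1
  have := (hc.adj_dist_le h2 c).1
  omega

theorem not_adj_of_neighborSet_eq {x z : V} (hN : G.neighborSet x = G.neighborSet z) :
    ¬ G.Adj x z := fun h => G.loopless.irrefl z ((Set.ext_iff.1 hN z).1 h)

theorem Connected.dist_eq_two_of_neighborSet_eq (hc : G.Connected) {x z : V} (hxz : x ≠ z)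
    (hN : G.neighborSet x = G.neighborSet z) : G.dist x z = 2 := by
  obtain ⟨t, ht, htd⟩ := hc.exists_adj_dist hxz
  rw [htd, ((Set.ext_iff.1 hN t).1 ht).symm.dist_eq_one]

/-- A line that is not generated with the help of the false twins `x` and `z` contains both or
none of them. -/
theorem Connected.mem_line_iff_of_neighborSet_eq (hc : G.Connected) {x z a b : V}
    (hN : G.neighborSet x = G.neighborSet z) (hax : a ≠ x) (haz : a ≠ z) (hbx : b ≠ x)
    (hbz : b ≠ z) (hab : a ≠ b) : x ∈ G.line a b ↔ z ∈ G.line a b := by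
  rw [mem_line_iff hab, mem_line_iff hab]
  have h1 := hc.dist_eq_of_neighborSet_eq hN hax haz
  have h2 := hc.dist_eq_of_neighborSet_eq hN hbx hbz
  rw [dist_comm (u := a) (v := x), dist_comm (u := a) (v := z), dist_comm (u := b) (v := x),
    dist_comm (u := b) (v := z), h1, h2]

/-- Let `x` and `z` be false twins. The line `x b` contains `z` exactly when `b` is a common
neighbour of `x` and `z`. -/
theorem Connected.twin_mem_line (hc : G.Connected) {x z b : V} (hxz : x ≠ z)
    (hN : G.neighborSet x = G.neighborSet z) (hbx : b ≠ x) (hbz : b ≠ z) :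
    z ∈ G.line x b ↔ G.Adj x b := by
  rw [mem_line_iff hbx.symm, ← dist_eq_one_iff_adj]
  have h1 := hc.dist_eq_of_neighborSet_eq hN hbx hbz
  have h2 := hc.dist_eq_two_of_neighborSet_eq hxz hN
  have h3 := hc.pos_dist_of_ne hbx
  have := G.dist_comm (u := b) (v := x)
  have := G.dist_comm (u := b) (v := z)
  have := G.dist_comm (u := x) (v := z)
  omega

/-- If the false twins `x` and `z` have a further common non-neighbour `u`, then removing `z`
destroys a line: `z u` contains `z` but not `x`, unlike all lines generated within `G - z`. -/
theorem Connected.ncard_lines_removed_lt [Finite V] (hc : G.Connected) {x z u : V} (hxz : x ≠ z)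
    (hN : G.neighborSet x = G.neighborSet z) (hux : u ≠ x) (huz : u ≠ z) (hu : ¬ G.Adj x u) :
    (G.removed z).lines.ncard < G.lines.ncard := by
  have hM : G.line z u ∈ G.lines := ⟨z, u, huz.symm, rfl⟩
  have hsub : (G.removed z).lines ⊆
      (fun L : Set V => (Subtype.val ⁻¹' L : Set {y // y ≠ z})) '' (G.lines \ {G.line z u}) := by
    rintro L ⟨a, b, hab, rfl⟩
    have hab' : (a : V) ≠ b := fun h => hab (Subtype.ext h)
    refine ⟨G.line a b, ⟨⟨a, b, hab', rfl⟩, fun h => ?_⟩,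
      (Set.ext fun c => (hc.mem_line_removed hxz hN hab c)).symm⟩
    have hz : z ∈ G.line a b := by
      rw [Set.mem_singleton_iff.1 h]
      exact left_mem_line z u
    have hx : x ∉ G.line a b := by
      rw [Set.mem_singleton_iff.1 h, hc.twin_mem_line hxz.symm hN.symm huz hux]
      exact fun h => hu ((Set.ext_iff.1 hN u).2 h)
    by_cases hax : (a : V) = x
    · exact hx (hax ▸ left_mem_line _ _)
    by_cases hbx : (b : V) = x
    · exact hx (hbx ▸ right_mem_line _ _)
    exact hx ((hc.mem_line_iff_of_neighborSet_eq hN hax a.2 hbx b.2 hab').2 hz)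
  calc (G.removed z).lines.ncard ≤ _ := Set.ncard_le_ncard hsub (Set.toFinite _)
    _ ≤ (G.lines \ {G.line z u}).ncard := Set.ncard_image_le (Set.toFinite _)
    _ < G.lines.ncard := Set.ncard_sdiff_singleton_lt_of_mem hM

/-- If `p`, `q`, `r` are false twins adjacent to all other vertices, then the line `p q` misses
exactly `r`. -/
theorem Connected.line_eq_compl_of_triple (hc : G.Connected) {p q r : V} (hpq : p ≠ q)
    (hpr : p ≠ r) (hqr : q ≠ r) (hN : G.neighborSet p = G.neighborSet q)
    (hN' : G.neighborSet p = G.neighborSet r) (h : ∀ c, c ≠ p → c ≠ q → c ≠ r → G.Adj p c) :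
    G.line p q = {r}ᶜ := by
  ext c
  rw [Set.mem_compl_singleton_iff]
  have hd := hc.dist_eq_two_of_neighborSet_eq hpq hN
  refine ⟨?_, fun hcr => ?_⟩
  · rintro hcl rfl
    rw [hc.twin_mem_line hpr hN' hpq.symm hqr] at hcl
    exact not_adj_of_neighborSet_eq hN hcl
  · by_cases hcp : c = p
    · rw [hcp]
      exact left_mem_line p q
    by_cases hcq : c = q
    · rw [hcq]
      exact right_mem_line p q
    have h1 := h c hcp hcq hcr
    have h2 : G.Adj q c := (Set.ext_iff.1 hN c).1 h1
    rw [mem_line_iff hpq, hd, h1.dist_eq_one, h2.symm.dist_eq_one]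
    exact .inl rfl

/-- If `x`, `z`, `u` are false twins adjacent to all other vertices, and some other pair generates
the universal line, then removing `z` destroys three lines: each line of `G - z` extends to a line
of `G` other than the three complements of `x`, `z` and `u`. -/
theorem Connected.ncard_lines_removed_add_three_le [Finite V] (hc : G.Connected) {x z u : V}
    (hxz : x ≠ z) (hxu : x ≠ u) (hzu : z ≠ u) (hN : G.neighborSet x = G.neighborSet z)
    (hN' : G.neighborSet x = G.neighborSet u) (h : ∀ c, c ≠ x → c ≠ z → c ≠ u → G.Adj x c)
    (huniv : Set.univ ∈ G.lines) :
    (G.removed z).lines.ncard + 3 ≤ G.lines.ncard := by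
  have hx : G.line z u = {x}ᶜ := hc.line_eq_compl_of_triple hzu hxz.symm hxu.symm
    (hN.symm.trans hN') hN.symm fun c h1 h2 h3 => (Set.ext_iff.1 hN c).1 (h c h3 h1 h2)
  have hu : G.line x z = {u}ᶜ := hc.line_eq_compl_of_triple hxz hxu hzu hN hN' h
  have hz : G.line x u = {z}ᶜ := hc.line_eq_compl_of_triple hxu hxz hzu.symm hN' hN
    fun c h1 h2 h3 => h c h1 h3 h2
  set M : Set (Set V) := {{x}ᶜ, {z}ᶜ, {u}ᶜ} with hMdef
  have hM : M ⊆ G.lines := by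
    rintro L (rfl | rfl | rfl)
    · exact ⟨z, u, hzu, hx.symm⟩
    · exact ⟨x, u, hxu, hz.symm⟩
    · exact ⟨x, z, hxz, hu.symm⟩
  have hMcard : M.ncard = 3 := by
    rw [Set.ncard_eq_three]
    exact ⟨_, _, _, by simpa using hxz, by simpa using hxu, by simpa using hzu, rfl⟩
  -- A line containing all or none of the three twins is not in `M`.
  have hMnot : ∀ L : Set V, (x ∈ L ↔ z ∈ L) → (x ∈ L ↔ u ∈ L) → L ∉ M := by
    rintro L h1 h2 (rfl | rfl | rfl)
    · simp [hxz.symm] at h1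
    · simp [hxz] at h1
    · simp [hxu] at h2
  have hsub : (G.removed z).lines ⊆
      (fun L : Set V => (Subtype.val ⁻¹' L : Set {y // y ≠ z})) '' (G.lines \ M) := by
    rintro L ⟨a, b, hab, rfl⟩
    have hab' : (a : V) ≠ b := fun h => hab (Subtype.ext h)
    by_cases hau : ((a : V) = x ∧ (b : V) = u) ∨ ((a : V) = u ∧ (b : V) = x)
    · refine ⟨Set.univ, ⟨huniv, hMnot _ (by simp) (by simp)⟩, ?_⟩
      ext c
      rw [hc.mem_line_removed hxz hN hab]
      have hL : G.line (a : V) b = {z}ᶜ := by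
        rcases hau with ⟨h1, h2⟩ | ⟨h1, h2⟩
        · rw [h1, h2, hz]
        · rw [h1, h2, line_comm, hz]
      rw [hL]
      simpa using c.2
    · refine ⟨G.line a b, ⟨⟨a, b, hab', rfl⟩, ?_⟩,
        (Set.ext fun c => (hc.mem_line_removed hxz hN hab c)).symm⟩
      -- Lines through one of the twins and a vertex adjacent to all of them.
      have key : ∀ b, b ≠ x → b ≠ z → b ≠ u → G.line x b ∉ M ∧ G.line u b ∉ M := by
        intro b hbx hbz hbu
        have h1 := h b hbx hbz hbu
        have h2 : G.Adj u b := (Set.ext_iff.1 hN' b).1 h1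
        have h3 := (hc.twin_mem_line hxz hN hbx hbz).2 h1
        have h4 := (hc.twin_mem_line hxu hN' hbx hbu).2 h1
        have h5 := (hc.twin_mem_line hzu.symm (hN'.symm.trans hN) hbu hbz).2 h2
        have h6 := (hc.twin_mem_line hxu.symm hN'.symm hbu hbx).2 h2
        exact ⟨hMnot _ (iff_of_true (left_mem_line _ _) h3) (iff_of_true (left_mem_line _ _) h4),
          hMnot _ (iff_of_true h6 h5) (iff_of_true h6 (left_mem_line _ _))⟩
      have haz := a.2
      have hbz := b.2
      generalize (a : V) = a at *
      generalize (b : V) = b at *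
      by_cases hax : a = x
      · subst hax
        exact (key b hab'.symm hbz (by tauto)).1
      by_cases hau' : a = u
      · subst hau'
        exact (key b (by tauto) hbz hab'.symm).2
      by_cases hbx : b = x
      · subst hbx
        exact line_comm a b ▸ (key a hax haz hau').1
      by_cases hbu : b = u
      · subst hbu
        exact line_comm a b ▸ (key a hax haz hau').2
      exact hMnot _ (hc.mem_line_iff_of_neighborSet_eq hN hax haz hbx hbz hab')
        (hc.mem_line_iff_of_neighborSet_eq hN' hax hau' hbx hbu hab')
  have h1 : (G.removed z).lines.ncard ≤ (G.lines \ M).ncard :=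
    (Set.ncard_le_ncard hsub (Set.toFinite _)).trans (Set.ncard_image_le (Set.toFinite _))
  have h2 := Set.ncard_sdiff_add_ncard_of_subset hM (Set.toFinite _)
  omega

/-! ### Complete multipartite graphs -/

/-- A graph in which adjacency means having different colours is determined by the sizes of its
colour classes. -/
theorem nonempty_iso_completeMultipartiteGraph [Fintype V] {k : ℕ} (f : V → Fin k) (m : Fin k → ℕ)
    (hf : ∀ a b, G.Adj a b ↔ f a ≠ f b) (hm : ∀ i, Nat.card {x // f x = i} = m i) :
    Nonempty (G ≃g completeMultipartiteGraph fun i => Fin (m i)) := by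
  let e : V ≃ Σ i, Fin (m i) := (Equiv.sigmaFiberEquiv f).symm.trans
    (Equiv.sigmaCongrRight fun i => Finite.equivFinOfCardEq (hm i))
  refine ⟨e, fun {a b} => ?_⟩
  rw [hf]
  rfl

theorem Iso.adj_iff_fst_ne {k : ℕ} {m : Fin k → ℕ}
    (φ : G ≃g completeMultipartiteGraph fun i => Fin (m i)) (a b : V) :
    G.Adj a b ↔ (φ a).1 ≠ (φ b).1 := by
  rw [← φ.map_adj_iff]
  rfl

/-- A connected graph in which adjacency means having one of `k` different colours, each used at
most twice, has at most `k.choose 2 + 1` lines: the unions of two colour classes, and the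
universal line. -/
theorem Connected.ncard_lines_le_of_coloring [Finite V] (hc : G.Connected) {k : ℕ} (f : V → Fin k)
    (hf : ∀ a b, G.Adj a b ↔ f a ≠ f b)
    (hm : ∀ a b c, a ≠ b → f a = f b → f c = f a → c = a ∨ c = b) :
    G.lines.ncard ≤ k.choose 2 + 1 := by
  classical
  have hN : ∀ a b, f a = f b → G.neighborSet a = G.neighborSet b := fun a b hab =>
    Set.ext fun c => by rw [mem_neighborSet, mem_neighborSet, hf, hf, hab]
  have hsub : G.lines ⊆ ↑(insert Set.univ ((Finset.univ.powersetCard 2).image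
      fun s : Finset (Fin k) => {c : V | f c ∈ s})) := by
    rintro L ⟨a, b, hab, rfl⟩
    rw [Finset.mem_coe, Finset.mem_insert, Finset.mem_image]
    by_cases hfab : f a = f b
    · left
      refine Set.eq_univ_of_forall fun c => ?_
      by_cases hfc : f c = f a
      · rcases hm a b c hab hfab hfc with rfl | rfl
        · exact left_mem_line _ _
        · exact right_mem_line _ _
      · have h1 : G.Adj a c := (hf a c).2 (Ne.symm hfc)
        have h2 : G.Adj c b := (hf c b).2 (hfab ▸ hfc)
        rw [mem_line_iff hab, hc.dist_eq_two_of_neighborSet_eq hab (hN a b hfab),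
          h1.dist_eq_one, h2.dist_eq_one]
        exact .inl rfl
    · right
      refine ⟨{f a, f b}, ?_, ?_⟩
      · rw [Finset.mem_powersetCard]
        exact ⟨Finset.subset_univ _, Finset.card_pair hfab⟩
      · have hadj : G.Adj a b := (hf a b).2 hfab
        have hd : ∀ a b c, G.Adj a b → f c = f a → G.dist a c ≠ G.dist b c := by
          intro a b c hadj hfc
          have h1 : G.dist b c = 1 := dist_eq_one_iff_adj.2 ((hf b c).2 (by
            rw [hfc]; exact ((hf a b).1 hadj).symm))
          have h2 : ¬ G.dist a c = 1 := fun h => (hf a c).1 (dist_eq_one_iff_adj.1 h) hfc.symm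
          rwa [h1]
        ext c
        rw [hc.mem_line_adj hadj]
        simp only [Finset.mem_insert, Finset.mem_singleton, Set.mem_ofPred_eq]
        constructor
        · rintro (h | h)
          · exact hd a b c hadj h
          · exact (hd b a c hadj.symm h).symm
        · intro h
          by_contra! h'
          exact h (by rw [((hf a c).2 h'.1.symm).dist_eq_one, ((hf b c).2 h'.2.symm).dist_eq_one])
  calc G.lines.ncard ≤ _ := Set.ncard_le_ncard hsub (Finset.finite_toSet _)
    _ = _ := Set.ncard_coe_finset _
    _ ≤ _ := Finset.card_insert_le _ _
    _ ≤ ((Finset.univ : Finset (Fin k)).powersetCard 2).card + 1 := by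
      gcongr
      exact Finset.card_image_le
    _ = k.choose 2 + 1 := by rw [Finset.card_powersetCard, Finset.card_univ, Fintype.card_fin]

/-- `G` is one of the complete multipartite graphs with fewer lines than vertices. -/
def IsExceptional (G : SimpleGraph V) : Prop :=
  Nonempty (G ≃g K122) ∨ Nonempty (G ≃g K222) ∨ Nonempty (G ≃g K2222)

theorem Connected.ncard_lines_lt_of_iso [Fintype V] (hc : G.Connected) {k : ℕ} {m : Fin k → ℕ}
    (φ : G ≃g completeMultipartiteGraph fun i => Fin (m i)) (hm : ∀ i, m i ≤ 2)
    (hlt : k.choose 2 + 1 < ∑ i, m i) : G.lines.ncard < Fintype.card V := by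
  have h1 : Fintype.card V = ∑ i, m i := by
    rw [Fintype.card_congr φ.toEquiv, Fintype.card_sigma]
    simp
  rw [h1]
  refine (hc.ncard_lines_le_of_coloring (fun a => (φ a).1) φ.adj_iff_fst_ne ?_).trans_lt hlt
  intro a b c hab h1 h2
  have hab' : φ a ≠ φ b := φ.injective.ne hab
  rw [← φ.injective.eq_iff, ← φ.injective.eq_iff (b := b)]
  generalize φ a = a at *
  generalize φ b = b at *
  generalize φ c = c at *
  obtain ⟨i, a⟩ := a
  obtain ⟨j, b⟩ := b
  obtain ⟨l, c⟩ := c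
  obtain rfl : i = j := h1
  obtain rfl : l = i := h2
  have h3 := hm l
  have h4 : a ≠ b := fun h => hab' (h ▸ rfl)
  have h5 : c = a ∨ c = b := by
    have := a.2
    have := b.2
    have := c.2
    rw [Ne, Fin.ext_iff] at h4
    rw [Fin.ext_iff, Fin.ext_iff]
    omega
  rcases h5 with rfl | rfl
  · exact .inl rfl
  · exact .inr rfl

theorem Connected.ncard_lines_lt_of_isExceptional [Fintype V] (hc : G.Connected)
    (h : G.IsExceptional) : G.lines.ncard < Fintype.card V := by
  obtain ⟨⟨φ⟩⟩ | ⟨⟨φ⟩⟩ | ⟨⟨φ⟩⟩ := h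
  · exact hc.ncard_lines_lt_of_iso (m := ![1, 2, 2]) φ (by decide) (by decide)
  · exact hc.ncard_lines_lt_of_iso (m := fun _ => 2) φ (by decide) (by decide)
  · exact hc.ncard_lines_lt_of_iso (m := fun _ => 2) φ (by decide) (by decide)

/-- In the exceptional graphs, two non-adjacent vertices are adjacent to all other vertices, and
there is a further pair of non-adjacent vertices. -/
theorem IsExceptional.of_not_adj (h : G.IsExceptional) {x u : V} (hxu : x ≠ u)
    (hn : ¬ G.Adj x u) : (∀ c, c ≠ x → c ≠ u → G.Adj x c ∧ G.Adj u c) ∧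
      ∃ y y', y ≠ y' ∧ ¬ G.Adj y y' ∧ G.Adj x y ∧ G.Adj x y' := by
  have key : ∀ {k : ℕ} {m : Fin k → ℕ},
      (∀ x u : Σ i, Fin (m i), x ≠ u → x.1 = u.1 →
        (∀ c : Σ i, Fin (m i), c ≠ x → c ≠ u → x.1 ≠ c.1) ∧
        ∃ y y' : Σ i, Fin (m i), y ≠ y' ∧ y.1 = y'.1 ∧ x.1 ≠ y.1) →
      (G ≃g completeMultipartiteGraph fun i => Fin (m i)) →
      (∀ c, c ≠ x → c ≠ u → G.Adj x c ∧ G.Adj u c) ∧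
        ∃ y y', y ≠ y' ∧ ¬ G.Adj y y' ∧ G.Adj x y ∧ G.Adj x y' := by
    intro k m hm φ
    have hadj := φ.adj_iff_fst_ne
    have hxu' : (φ x).1 = (φ u).1 := by
      by_contra h
      exact hn ((hadj x u).2 h)
    obtain ⟨h1, y, y', h2, h3, h4⟩ := hm (φ x) (φ u) (φ.injective.ne hxu) hxu'
    refine ⟨fun c hcx hcu => ?_, φ.symm y, φ.symm y', φ.symm.injective.ne h2, ?_, ?_, ?_⟩
    · have h5 := h1 (φ c) (φ.injective.ne hcx) (φ.injective.ne hcu)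
      exact ⟨(hadj x c).2 h5, (hadj u c).2 (hxu' ▸ h5)⟩
    · simpa [hadj] using h3
    · simpa [hadj] using h4
    · simpa [hadj, ← h3] using h4
  obtain ⟨⟨φ⟩⟩ | ⟨⟨φ⟩⟩ | ⟨⟨φ⟩⟩ := h
  · exact key (m := ![1, 2, 2]) (by decide) φ
  · exact key (m := fun _ => 2) (by decide) φ
  · exact key (m := fun _ => 2) (by decide) φ

/-! ### Graphs whose false twins are adjacent to all other vertices -/

/-- Every vertex that has a false twin is adjacent to all vertices other than itself and that
twin. -/
def TwinsDominate (G : SimpleGraph V) : Prop :=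
  ∀ x z, x ≠ z → G.neighborSet x = G.neighborSet z → ∀ c, c ≠ x → c ≠ z → G.Adj x c

/-- A representative of the class of false twins of `x`. -/
noncomputable def twinRep (G : SimpleGraph V) (x : V) : V :=
  (Quotient.mk (Setoid.ker G.neighborSet) x).out

theorem neighborSet_twinRep (x : V) : G.neighborSet (G.twinRep x) = G.neighborSet x :=
  Quotient.mk_out (s := Setoid.ker G.neighborSet) x

theorem twinRep_eq_iff {x y : V} :
    G.twinRep x = G.twinRep y ↔ G.neighborSet x = G.neighborSet y := by
  rw [twinRep, twinRep, Quotient.out_inj, Quotient.eq]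
  rfl

/-- Each class of false twins has exactly two members. -/
theorem TwinsDominate.eq_or_eq (hU : G.TwinsDominate) {x z c : V} (hxz : x ≠ z)
    (hN : G.neighborSet x = G.neighborSet z) (hc : G.neighborSet c = G.neighborSet x) :
    c = x ∨ c = z := by
  by_contra! h
  exact not_adj_of_neighborSet_eq hc.symm (hU x z hxz hN c h.1 h.2)

theorem TwinsDominate.line_eq_univ (hU : G.TwinsDominate) (hc : G.Connected) {x z : V}
    (hxz : x ≠ z) (hN : G.neighborSet x = G.neighborSet z) : G.line x z = Set.univ := by
  refine Set.eq_univ_of_forall fun c => ?_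
  by_cases hcx : c = x
  · rw [hcx]; exact left_mem_line _ _
  by_cases hcz : c = z
  · rw [hcz]; exact right_mem_line _ _
  rw [mem_line_iff hxz, hc.dist_eq_two_of_neighborSet_eq hxz hN,
    (hU x z hxz hN c hcx hcz).dist_eq_one, (hU z x hxz.symm hN.symm c hcz hcx).symm.dist_eq_one]
  exact .inl rfl

section
variable [Fintype V]

open Classical in
/-- The vertices that have a false twin. -/
noncomputable def twinned (G : SimpleGraph V) : Finset V :=
  {x | ∃ z, x ≠ z ∧ G.neighborSet x = G.neighborSet z}

open Classical in
/-- The vertices that have a false twin and represent its class. -/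
noncomputable def twinReps (G : SimpleGraph V) : Finset V :=
  {x ∈ G.twinned | G.twinRep x = x}

open Classical in
/-- The vertices that have no false twin. -/
noncomputable def untwinned (G : SimpleGraph V) : Finset V := G.twinnedᶜ

theorem mem_twinned {x : V} :
    x ∈ G.twinned ↔ ∃ z, x ≠ z ∧ G.neighborSet x = G.neighborSet z := by
  simp [twinned]

theorem mem_twinReps {x : V} : x ∈ G.twinReps ↔ x ∈ G.twinned ∧ G.twinRep x = x := by
  simp [twinReps]

theorem mem_untwinned {x : V} : x ∈ G.untwinned ↔ x ∉ G.twinned := by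
  simp [untwinned]

theorem twinRep_mem_twinReps {x : V} (hx : x ∈ G.twinned) : G.twinRep x ∈ G.twinReps := by
  refine mem_twinReps.2 ⟨?_, twinRep_eq_iff.2 (neighborSet_twinRep x)⟩
  by_cases h : G.twinRep x = x
  · rwa [h]
  · exact mem_twinned.2 ⟨x, h, neighborSet_twinRep x⟩

theorem TwinsDominate.adj (hU : G.TwinsDominate) {a b : V} (ha : a ∈ G.twinned)
    (hab : G.neighborSet a ≠ G.neighborSet b) : G.Adj a b := by
  obtain ⟨z, haz, hN⟩ := mem_twinned.1 ha
  exact hU a z haz hN b (fun h => hab (h ▸ rfl)) (fun h => hab (h ▸ hN))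

theorem TwinsDominate.not_adj_iff (hU : G.TwinsDominate) {a b : V} (ha : a ∈ G.twinned) :
    ¬ G.Adj a b ↔ G.neighborSet b = G.neighborSet a := by
  refine ⟨fun h => ?_, fun h => not_adj_of_neighborSet_eq h.symm⟩
  by_contra hne
  exact h (hU.adj ha (Ne.symm hne))

theorem TwinsDominate.adj_untwinned (hU : G.TwinsDominate) {a b : V} (ha : a ∈ G.twinned)
    (hb : b ∈ G.untwinned) : G.Adj a b := by
  refine hU.adj ha fun h => mem_untwinned.1 hb (mem_twinned.2 ⟨a, ?_, h.symm⟩)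
  rintro rfl
  exact mem_untwinned.1 hb ha

theorem TwinsDominate.card_le (hU : G.TwinsDominate) :
    Fintype.card V ≤ 2 * G.twinReps.card + G.untwinned.card := by
  classical
  have h1 : G.twinned.card + G.untwinned.card = Fintype.card V := Finset.card_add_card_compl _
  have h2 := Finset.card_filter_add_card_filter_not (s := G.twinned) fun x => G.twinRep x = x
  have h3 : (G.twinned.filter fun x => ¬ G.twinRep x = x).card ≤ G.twinReps.card := by
    refine Finset.card_le_card_of_injOn G.twinRep
      (fun x hx => twinRep_mem_twinReps (Finset.mem_filter.1 hx).1) fun x hx y hy hxy => ?_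
    by_contra hne
    have hx' : G.twinRep x ≠ x := (Finset.mem_filter.1 hx).2
    have hy' : G.twinRep y ≠ y := (Finset.mem_filter.1 hy).2
    rcases hU.eq_or_eq hne (twinRep_eq_iff.1 hxy) (neighborSet_twinRep x) with h | h
    · exact hx' h
    · exact hy' (hxy ▸ h)
  have h4 : G.twinReps = G.twinned.filter fun x => G.twinRep x = x := by
    ext x; rw [mem_twinReps, Finset.mem_filter]
  rw [← h4] at h2
  omega

theorem TwinsDominate.mem_line (hU : G.TwinsDominate) (hc : G.Connected) {a b : V}
    (ha : a ∈ G.twinned) (hab : G.Adj a b) (c : V) :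
    c ∈ G.line a b ↔ G.neighborSet c = G.neighborSet a ∨ ¬ G.Adj b c := by
  rw [hc.mem_line_adj hab]
  by_cases hN : G.neighborSet c = G.neighborSet a
  · have h1 : G.Adj b c := ((Set.ext_iff.1 hN b).2 hab).symm
    have h2 : G.dist a c ≠ 1 := fun h => (hU.not_adj_iff ha).2 hN (dist_eq_one_iff_adj.1 h)
    simp [hN, h1.dist_eq_one, h2]
  · rw [(hU.adj ha (Ne.symm hN)).dist_eq_one, ← dist_eq_one_iff_adj]
    simp only [hN, false_or]
    exact ne_comm

/-- The line of a representative `a` and an untwinned vertex `b` determines both: `a` is its only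
representative, and it contains those untwinned vertices that are not adjacent to `b`. -/
theorem TwinsDominate.line_injOn (hU : G.TwinsDominate) (hc : G.Connected) {a b a' b' : V}
    (ha : a ∈ G.twinReps) (hb : b ∈ G.untwinned) (ha' : a' ∈ G.twinReps) (hb' : b' ∈ G.untwinned)
    (h : G.line a b = G.line a' b') : a = a' ∧ b = b' := by
  have hm := hU.mem_line hc (mem_twinReps.1 ha).1 (hU.adj_untwinned (mem_twinReps.1 ha).1 hb)
  have hm' := hU.mem_line hc (mem_twinReps.1 ha').1
    (hU.adj_untwinned (mem_twinReps.1 ha').1 hb')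
  have hadj : ∀ b ∈ G.untwinned, ∀ c ∈ G.twinned, G.Adj b c := fun b hb c hc =>
    (hU.adj_untwinned hc hb).symm
  constructor
  · have h1 := h ▸ left_mem_line (G := G) a b
    rw [hm'] at h1
    have h2 := h1.resolve_right (not_not.2 (hadj b' hb' a (mem_twinReps.1 ha).1))
    rw [← (mem_twinReps.1 ha).2, ← (mem_twinReps.1 ha').2]
    exact twinRep_eq_iff.2 h2
  · by_contra hne
    refine mem_untwinned.1 hb (mem_twinned.2 ⟨b', hne, Set.ext fun c => ?_⟩)
    rw [mem_neighborSet, mem_neighborSet]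
    by_cases hct : c ∈ G.twinned
    · exact iff_of_true (hadj b hb c hct) (hadj b' hb' c hct)
    · have h1 := hm c
      rw [h, hm'] at h1
      have h2 : ∀ a ∈ G.twinReps, G.neighborSet c ≠ G.neighborSet a := by
        intro a ha hca
        refine hct (mem_twinned.2 ⟨a, ?_, hca⟩)
        rintro rfl
        exact hct (mem_twinReps.1 ha).1
      have := h2 a ha
      have := h2 a' ha'
      tauto

/-- The line of an edge is not universal. -/
theorem LocallyConnected.line_ne_univ (hl : G.LocallyConnected) (hc : G.Connected)
    (hn : 3 ≤ Fintype.card V) {a b : V} (hab : G.Adj a b) : G.line a b ≠ Set.univ := by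
  obtain ⟨c, h1, h2⟩ := hl.exists_triangle hc hn hab
  intro h
  have h3 := h ▸ Set.mem_univ c
  rw [hc.mem_line_adj hab, h1.dist_eq_one, h2.dist_eq_one] at h3
  exact h3 rfl

open Classical in
/-- The lines found in a graph with dominating false twins: the lines of a twinned and an untwinned
vertex, the unions of two classes of twins, and the universal line. -/
noncomputable def twinLines (G : SimpleGraph V) : Finset (Set V) :=
  insert Set.univ
    ((G.twinReps ×ˢ G.untwinned).image (fun p => G.line p.1 p.2) ∪
      (G.twinReps.powersetCard 2).image fun s => {c | G.twinRep c ∈ s})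

/-- A union of two classes of twins is the line of an edge. -/
theorem TwinsDominate.exists_line_eq (hU : G.TwinsDominate) (hc : G.Connected) {s : Finset V}
    (hs : s ∈ G.twinReps.powersetCard 2) :
    ∃ a ∈ s, ∃ b ∈ s, G.Adj a b ∧ {c | G.twinRep c ∈ s} = G.line a b := by
  classical
  rw [Finset.mem_powersetCard] at hs
  obtain ⟨a, b, hab, rfl⟩ := Finset.card_eq_two.1 hs.2
  have ha := mem_twinReps.1 (hs.1 (Finset.mem_insert_self a _))
  have hb := mem_twinReps.1 (hs.1 (Finset.mem_insert_of_mem (Finset.mem_singleton_self b)))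
  have hrep : ∀ {a c : V}, G.twinRep a = a →
      (G.twinRep c = a ↔ G.neighborSet c = G.neighborSet a) := by
    intro a c ha
    rw [← twinRep_eq_iff, ha]
  have hadj : G.Adj a b := hU.adj ha.1 fun h => hab (by
    rw [← ha.2, ← hb.2]; exact twinRep_eq_iff.2 h)
  refine ⟨a, by simp, b, by simp, hadj, Set.ext fun c => ?_⟩
  rw [hU.mem_line hc ha.1 hadj, hU.not_adj_iff hb.1]
  simp only [Set.mem_ofPred_eq, Finset.mem_insert, Finset.mem_singleton]
  rw [hrep ha.2, hrep hb.2]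

theorem TwinsDominate.twinLines_subset (hU : G.TwinsDominate) (hc : G.Connected)
    (hne : G.twinned.Nonempty) : (G.twinLines : Set (Set V)) ⊆ G.lines := by
  classical
  intro L hL
  rw [Finset.mem_coe, twinLines, Finset.mem_insert, Finset.mem_union, Finset.mem_image,
    Finset.mem_image] at hL
  rcases hL with rfl | ⟨⟨a, b⟩, hp, rfl⟩ | ⟨s, hs, rfl⟩
  · obtain ⟨x, hx⟩ := hne
    obtain ⟨z, hxz, hN⟩ := mem_twinned.1 hx
    exact ⟨x, z, hxz, (hU.line_eq_univ hc hxz hN).symm⟩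
  · rw [Finset.mem_product] at hp
    exact ⟨a, b, (hU.adj_untwinned (mem_twinReps.1 hp.1).1 hp.2).ne, rfl⟩
  · obtain ⟨a, -, b, -, hab, h⟩ := hU.exists_line_eq hc hs
    exact ⟨a, b, hab.ne, h⟩

theorem TwinsDominate.card_twinLines (hU : G.TwinsDominate) (hl : G.LocallyConnected)
    (hc : G.Connected) (hn : 3 ≤ Fintype.card V) :
    G.twinLines.card =
      G.twinReps.card * G.untwinned.card + G.twinReps.card.choose 2 + 1 := by
  classical
  -- Restricting a union of classes of twins to the representatives recovers the classes.
  have htrace : ∀ s ∈ G.twinReps.powersetCard 2, ∀ c ∈ G.twinReps,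
      c ∈ ({c | G.twinRep c ∈ s} : Set V) ↔ c ∈ s := by
    intro s _ c hc
    rw [Set.mem_ofPred_eq, (mem_twinReps.1 hc).2]
  rw [twinLines, Finset.card_insert_of_notMem, Finset.card_union_of_disjoint,
    Finset.card_image_of_injOn, Finset.card_image_of_injOn, Finset.card_product,
    Finset.card_powersetCard]
  · intro s hs t ht hst
    have hs' := (Finset.mem_powersetCard.1 (Finset.mem_coe.1 hs)).1
    have ht' := (Finset.mem_powersetCard.1 (Finset.mem_coe.1 ht)).1
    ext c
    constructor
    · intro h
      rw [← htrace t ht c (hs' h)]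
      exact (Set.ext_iff.1 hst c).1 ((htrace s hs c (hs' h)).2 h)
    · intro h
      rw [← htrace s hs c (ht' h)]
      exact (Set.ext_iff.1 hst c).2 ((htrace t ht c (ht' h)).2 h)
  · rintro ⟨a, b⟩ hp ⟨a', b'⟩ hp' h
    rw [Finset.mem_coe, Finset.mem_product] at hp hp'
    obtain ⟨rfl, rfl⟩ := hU.line_injOn hc hp.1 hp.2 hp'.1 hp'.2 h
    rfl
  · rw [Finset.disjoint_left]
    intro L hL hL'
    obtain ⟨⟨a, b⟩, hp, rfl⟩ := Finset.mem_image.1 hL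
    obtain ⟨s, hs, hsL⟩ := Finset.mem_image.1 hL'
    rw [Finset.mem_product] at hp
    have hs' := Finset.mem_powersetCard.1 hs
    have hat := (mem_twinReps.1 hp.1).1
    -- The only representative on the line `a b` is `a`.
    have honly : ∀ c ∈ s, c = a := by
      intro c hcs
      have h1 : c ∈ G.line a b := by
        have h2 := (htrace s hs c (hs'.1 hcs)).2 hcs
        exact (Set.ext_iff.1 hsL c).1 h2
      have hct := mem_twinReps.1 (hs'.1 hcs)
      rw [hU.mem_line hc hat (hU.adj_untwinned hat hp.2)] at h1
      have h3 := h1.resolve_right (not_not.2 (hU.adj_untwinned hct.1 hp.2).symm)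
      exact (hct.2.symm.trans (twinRep_eq_iff.2 h3)).trans (mem_twinReps.1 hp.1).2
    have h4 : s.card ≤ 1 := Finset.card_le_one.2 fun x hx y hy => by rw [honly x hx, honly y hy]
    omega
  · rw [Finset.mem_union, Finset.mem_image, Finset.mem_image]
    rintro (⟨⟨a, b⟩, hp, h⟩ | ⟨s, hs, h⟩)
    · rw [Finset.mem_product] at hp
      exact hl.line_ne_univ hc hn (hU.adj_untwinned (mem_twinReps.1 hp.1).1 hp.2) h
    · obtain ⟨a, -, b, -, hab, h'⟩ := hU.exists_line_eq hc hs
      exact hl.line_ne_univ hc hn hab (h'.symm.trans h)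

/-- If `G` has exactly one class of twins, then the untwinned vertices span a further line. -/
theorem LocallyConnected.exists_line_notMem_twinLines (hl : G.LocallyConnected)
    (hc : G.Connected) (hn : 3 ≤ Fintype.card V)
    (h1 : G.twinReps.card = 1) : ∃ L ∈ G.lines, L ∉ G.twinLines := by
  classical
  obtain ⟨a, hA⟩ := Finset.card_eq_one.1 h1
  have ha : a ∈ G.twinReps := hA ▸ Finset.mem_singleton_self a
  have hat := mem_twinReps.1 ha
  obtain ⟨⟨b, hb⟩⟩ := (hl a).nonempty
  obtain ⟨c, hac, hbc⟩ := hl.exists_triangle hc hn hb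
  refine ⟨G.line b c, ⟨b, c, hbc.ne, rfl⟩, fun h => ?_⟩
  have haL : a ∉ G.line b c := by
    rw [hc.mem_line_adj hbc, hb.symm.dist_eq_one, hac.symm.dist_eq_one]
    exact fun h => h rfl
  rw [twinLines, Finset.mem_insert, Finset.mem_union, Finset.mem_image, Finset.mem_image] at h
  rcases h with h | ⟨⟨a', b'⟩, hp, h⟩ | ⟨s, hs, -⟩
  · exact haL (h ▸ Set.mem_univ a)
  · rw [Finset.mem_product, hA, Finset.mem_singleton] at hp
    obtain rfl : a' = a := hp.1
    exact haL (h ▸ left_mem_line _ _)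
  · rw [Finset.mem_powersetCard] at hs
    have := Finset.card_le_card hs.1
    omega

theorem TwinsDominate.adj_iff (hU : G.TwinsDominate) (hW : G.untwinned.card ≤ 1) (a b : V) :
    G.Adj a b ↔ G.neighborSet a ≠ G.neighborSet b := by
  refine ⟨fun h h' => not_adj_of_neighborSet_eq h' h, fun h => ?_⟩
  by_cases ha : a ∈ G.twinned
  · exact hU.adj ha h
  by_cases hb : b ∈ G.twinned
  · exact (hU.adj hb h.symm).symm
  · exact absurd (congrArg G.neighborSet
      (Finset.card_le_one.1 hW a (mem_untwinned.2 ha) b (mem_untwinned.2 hb))) h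

theorem TwinsDominate.card_fiber (hU : G.TwinsDominate) {a : V} (ha : a ∈ G.twinReps) :
    Nat.card {x // G.twinRep x = a} = 2 := by
  classical
  obtain ⟨z, haz, hN⟩ := mem_twinned.1 (mem_twinReps.1 ha).1
  have h : ∀ x, G.twinRep x = a ↔ x ∈ ({a, z} : Finset V) := by
    intro x
    rw [← (mem_twinReps.1 ha).2, twinRep_eq_iff, (mem_twinReps.1 ha).2, Finset.mem_insert,
      Finset.mem_singleton]
    refine ⟨hU.eq_or_eq haz hN, ?_⟩
    rintro (rfl | rfl)
    · rfl
    · exact hN.symm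
  rw [Nat.card_congr (Equiv.subtypeEquivRight h), Nat.card_eq_fintype_card, Fintype.card_coe,
    Finset.card_pair haz]

/-- If all vertices are twinned, then `G` is complete multipartite with parts of size two. -/
theorem TwinsDominate.nonempty_iso (hU : G.TwinsDominate) (hW : G.untwinned.card = 0) {k : ℕ}
    (hk : G.twinReps.card = k) :
    Nonempty (G ≃g completeMultipartiteGraph fun _ : Fin k => Fin 2) := by
  have ht : ∀ x, x ∈ G.twinned := fun x => by
    by_contra h
    rw [Finset.card_eq_zero] at hW
    exact absurd (hW ▸ mem_untwinned.2 h) (Finset.notMem_empty x)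
  let e := Finset.equivFinOfCardEq hk
  let f : V → Fin k := fun x => e ⟨G.twinRep x, twinRep_mem_twinReps (ht x)⟩
  refine nonempty_iso_completeMultipartiteGraph f (fun _ => 2) (fun a b => ?_) fun i => ?_
  · rw [hU.adj_iff (by omega), ← twinRep_eq_iff.ne, e.injective.ne_iff, Subtype.mk_eq_mk.ne]
  · rw [← hU.card_fiber (e.symm i).2]
    refine Nat.card_congr (Equiv.subtypeEquivRight fun x => ?_)
    rw [← Equiv.eq_symm_apply, Subtype.ext_iff]

theorem TwinsDominate.nonempty_iso_K122 (hU : G.TwinsDominate) (hW : G.untwinned.card = 1)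
    (hk : G.twinReps.card = 2) : Nonempty (G ≃g K122) := by
  classical
  obtain ⟨w, hw⟩ := Finset.card_eq_one.1 hW
  have hmem : ∀ x, x ∉ G.twinned ↔ x = w := fun x => by
    rw [← mem_untwinned, hw, Finset.mem_singleton]
  let e := Finset.equivFinOfCardEq hk
  let f : V → Fin 3 := fun x =>
    if h : x ∈ G.twinned then (e ⟨G.twinRep x, twinRep_mem_twinReps h⟩).succ else 0
  have hf : ∀ x (h : x ∈ G.twinned), f x = (e ⟨G.twinRep x, twinRep_mem_twinReps h⟩).succ :=
    fun x h => dif_pos h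
  have hf0 : ∀ x, x ∉ G.twinned → f x = 0 := fun x h => dif_neg h
  refine nonempty_iso_completeMultipartiteGraph f ![1, 2, 2] (fun a b => ?_) fun i => ?_
  · by_cases ha : a ∈ G.twinned <;> by_cases hb : b ∈ G.twinned
    · rw [hf a ha, hf b hb, hU.adj_iff hW.le, ← twinRep_eq_iff.ne, (Fin.succ_injective _).ne_iff,
        e.injective.ne_iff, Subtype.mk_eq_mk.ne]
    · rw [hf a ha, hf0 b hb]
      exact iff_of_true (hU.adj_untwinned ha (mem_untwinned.2 hb)) (Fin.succ_ne_zero _)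
    · rw [hf b hb, hf0 a ha]
      exact iff_of_true (hU.adj_untwinned hb (mem_untwinned.2 ha)).symm
        (Fin.succ_ne_zero _).symm
    · rw [hf0 a ha, hf0 b hb, (hmem a).1 ha, (hmem b).1 hb]
      simp
  · refine Fin.cases ?_ (fun j => ?_) i
    · have h : ∀ x, f x = 0 ↔ x = w := by
        intro x
        rw [← hmem]
        refine ⟨fun h hx => ?_, hf0 x⟩
        rw [hf x hx] at h
        exact Fin.succ_ne_zero _ h
      rw [Nat.card_congr (Equiv.subtypeEquivRight h)]
      simp
    · have h : ∀ x, f x = j.succ ↔ G.twinRep x = (e.symm j : V) := by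
        intro x
        by_cases hx : x ∈ G.twinned
        · rw [hf x hx, (Fin.succ_injective _).eq_iff, ← Equiv.eq_symm_apply, Subtype.ext_iff]
        · rw [hf0 x hx]
          refine iff_of_false (Fin.succ_ne_zero _).symm fun h => hx ?_
          have h1 := (mem_twinReps.1 (e.symm j).2).1
          rw [← h, mem_twinned] at h1
          obtain ⟨z, hz, hN⟩ := h1
          rw [neighborSet_twinRep] at hN
          by_cases hxz : x = z
          · exact mem_twinned.2 ⟨G.twinRep x, fun h => hz (h.symm.trans hxz),
              (neighborSet_twinRep x).symm⟩
          · exact mem_twinned.2 ⟨z, hxz, hN⟩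
      rw [Nat.card_congr (Equiv.subtypeEquivRight h), hU.card_fiber (e.symm j).2]
      fin_cases j <;> rfl

/-- A graph with `g ≥ 1` pairs of twins, all of them dominating, and `w` further vertices has at
least `g * w + g.choose 2 + 1` lines, and one more if `g = 1`. -/
theorem TwinsDominate.card_le_ncard_lines_or (hU : G.TwinsDominate) (hl : G.LocallyConnected)
    (hc : G.Connected) (hn : 3 ≤ Fintype.card V) (hne : G.twinned.Nonempty) :
    Fintype.card V ≤ G.lines.ncard ∨
      G.IsExceptional ∧ Fintype.card V ≤ G.lines.ncard + 2 := by
  classical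
  have h1 := hU.card_le
  have hsub := hU.twinLines_subset hc hne
  have h2 : G.twinLines.card ≤ G.lines.ncard := by
    rw [← Set.ncard_coe_finset]
    exact Set.ncard_le_ncard hsub (Set.toFinite _)
  have h3 := hU.card_twinLines hl hc hn
  have hg : 1 ≤ G.twinReps.card := by
    obtain ⟨x, hx⟩ := hne
    exact Finset.card_pos.2 ⟨_, twinRep_mem_twinReps hx⟩
  have h4 : G.twinReps.card = 1 → G.twinLines.card + 1 ≤ G.lines.ncard := by
    intro hg1
    obtain ⟨L, hL, hL'⟩ := hl.exists_line_notMem_twinLines hc hn hg1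
    rw [← Finset.card_insert_of_notMem hL', ← Set.ncard_coe_finset, Finset.coe_insert]
    exact Set.ncard_le_ncard (Set.insert_subset hL hsub) (Set.toFinite _)
  -- Two pairs of twins alone form a 4-cycle, which is not locally connected.
  have h5 : G.twinReps.card = 2 → G.untwinned.card ≠ 0 := by
    intro hg2 hw0
    obtain ⟨a, b, hab, hA⟩ := Finset.card_eq_two.1 hg2
    have ha : a ∈ G.twinReps := by rw [hA]; simp
    have hb : b ∈ G.twinReps := by rw [hA]; simp
    have hN : G.neighborSet a ≠ G.neighborSet b := fun h => hab (by
      rw [← (mem_twinReps.1 ha).2, ← (mem_twinReps.1 hb).2]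
      exact twinRep_eq_iff.2 h)
    obtain ⟨c, h6, h7⟩ := hl.exists_triangle hc hn (hU.adj (mem_twinReps.1 ha).1 hN)
    have hct : c ∈ G.twinned := by
      by_contra h
      rw [Finset.card_eq_zero] at hw0
      exact absurd (hw0 ▸ mem_untwinned.2 h) (Finset.notMem_empty c)
    have h8 := twinRep_mem_twinReps hct
    rw [hA, Finset.mem_insert, Finset.mem_singleton] at h8
    rcases h8 with h8 | h8
    · exact not_adj_of_neighborSet_eq (h8 ▸ neighborSet_twinRep c) h6
    · exact not_adj_of_neighborSet_eq (h8 ▸ neighborSet_twinRep c) h7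
  obtain hg1 | hg2 | hg3 | hg4 | hg5 : G.twinReps.card = 1 ∨ G.twinReps.card = 2 ∨
      G.twinReps.card = 3 ∨ G.twinReps.card = 4 ∨ 5 ≤ G.twinReps.card := by omega
  · left
    have := h4 hg1
    rw [hg1] at h3 h1
    simp at h3
    omega
  · rw [hg2] at h3 h1
    norm_num at h3
    by_cases hw : G.untwinned.card = 1
    · exact .inr ⟨.inl (hU.nonempty_iso_K122 hw hg2), by omega⟩
    · have := h5 hg2
      left
      omega
  · rw [hg3] at h3 h1
    norm_num [Nat.choose] at h3
    by_cases hw : G.untwinned.card = 0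
    · exact .inr ⟨.inr (.inl (hU.nonempty_iso hw hg3)), by omega⟩
    · left
      omega
  · rw [hg4] at h3 h1
    norm_num [Nat.choose] at h3
    by_cases hw : G.untwinned.card = 0
    · exact .inr ⟨.inr (.inr (hU.nonempty_iso hw hg4)), by omega⟩
    · left
      omega
  · left
    generalize G.twinReps.card = g at *
    generalize G.untwinned.card = w at *
    have h6 : 2 * g ≤ g.choose 2 := by
      rw [Nat.choose_two_right, Nat.le_div_iff_mul_le two_pos, mul_right_comm, mul_comm (2 * 2)]
      exact Nat.mul_le_mul_left g (by omega)
    have h7 : w ≤ g * w := Nat.le_mul_of_pos_left w (by omega)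
    omega

end

/-! ### The number of lines of a locally connected graph -/

/-- Induction on the number of vertices: false twins with a further common non-neighbour are
removed until there are no false twins or they dominate. The bound in the exceptional case makes
up for the removal of a vertex. -/
theorem LocallyConnected.card_le_ncard_lines_or {V : Type*} [Fintype V] {G : SimpleGraph V}
    (hl : G.LocallyConnected) (hc : G.Connected)
    (hn : 3 ≤ Fintype.card V) :
    Fintype.card V ≤ G.lines.ncard ∨ G.IsExceptional ∧ Fintype.card V ≤ G.lines.ncard + 2 := by
  classical
  by_cases htf : Function.Injective G.neighborSet
  · exact .inl (hl.card_le_ncard_lines_of_injective hc htf hn)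
  by_cases hU : G.TwinsDominate
  · simp only [Function.Injective, not_forall] at htf
    obtain ⟨x, z, hN, hxz⟩ := htf
    exact hU.card_le_ncard_lines_or hl hc hn ⟨x, mem_twinned.2 ⟨z, hxz, hN⟩⟩
  simp only [TwinsDominate, not_forall] at hU
  obtain ⟨x, z, hxz, hN, u, hux, huz, hu⟩ := hU
  have hcard : Fintype.card {y // y ≠ z} = Fintype.card V - 1 := Set.card_ne_eq z
  -- `x`, `z`, `u` and a neighbour of `x` are four vertices.
  have hn' : 3 ≤ Fintype.card {y // y ≠ z} := by
    obtain ⟨⟨t, ht⟩⟩ := (hl x).nonempty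
    have ht' : G.Adj x t := ht
    have hs : ({⟨x, hxz⟩, ⟨u, huz⟩, ⟨t, fun h => not_adj_of_neighborSet_eq hN (h ▸ ht')⟩} :
        Finset {y // y ≠ z}).card = 3 := by
      rw [Finset.card_eq_three]
      refine ⟨_, _, _, ?_, ?_, ?_, rfl⟩
      · simpa using hux.symm
      · simpa using ht'.ne
      · simp only [ne_eq, Subtype.mk.injEq]
        rintro rfl
        exact hu ht'
    rw [← hs]
    exact Finset.card_le_univ _
  have hlt := hc.ncard_lines_removed_lt hxz hN hux huz hu
  rcases (hl.removed hxz hN).card_le_ncard_lines_or (hc.removed hxz hN) hn' with h | ⟨h1, h2⟩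
  · left; omega
  left
  have hxu' : (⟨x, hxz⟩ : {y // y ≠ z}) ≠ ⟨u, huz⟩ := by simpa using hux.symm
  obtain ⟨h3, y, y', h4, h5, h6, h7⟩ := h1.of_not_adj hxu' hu
  have hall : ∀ c, c ≠ x → c ≠ z → c ≠ u → G.Adj x c ∧ G.Adj u c := fun c hcx hcz hcu =>
    h3 ⟨c, hcz⟩ (by simpa using hcx) (by simpa using hcu)
  have hzu : ¬ G.Adj u z := fun h => hu ((Set.ext_iff.1 hN u).2 h.symm)
  have hN' : G.neighborSet x = G.neighborSet u := by
    ext c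
    rw [mem_neighborSet, mem_neighborSet]
    by_cases hcx : c = x
    · subst hcx
      exact iff_of_false (G.loopless.irrefl c) fun h => hu h.symm
    by_cases hcz : c = z
    · subst hcz
      exact iff_of_false (not_adj_of_neighborSet_eq hN) hzu
    by_cases hcu : c = u
    · subst hcu
      exact iff_of_false hu (G.loopless.irrefl c)
    exact iff_of_true (hall c hcx hcz hcu).1 (hall c hcx hcz hcu).2
  have huniv : Set.univ ∈ G.lines := by
    have hyy : (y : V) ≠ y' := fun h => h4 (Subtype.ext h)
    refine ⟨y, y', hyy, (Set.eq_univ_of_forall fun c => ?_).symm⟩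
    have h8 : ∀ c, c ≠ (y : V) → c ≠ y' → G.Adj y c ∧ G.Adj y' c := by
      intro c hcy hcy'
      by_cases hcz : c = z
      · subst hcz
        exact ⟨((Set.ext_iff.1 hN y).1 h6).symm, ((Set.ext_iff.1 hN y').1 h7).symm⟩
      · exact (h1.of_not_adj h4 h5).1 ⟨c, hcz⟩ (fun h => hcy (congrArg Subtype.val h))
          fun h => hcy' (congrArg Subtype.val h)
    have hd : G.dist (y : V) y' = 2 := by
      have h9 := hc.one_lt_dist_of_ne_of_not_adj hyy h5
      have h10 := hc.dist_triangle (u := (y : V)) (v := x) (w := y')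
      have h11 : G.Adj x y := h6
      have h12 : G.Adj x y' := h7
      rw [h11.symm.dist_eq_one, h12.dist_eq_one] at h10
      omega
    by_cases hcy : c = y
    · rw [hcy]; exact left_mem_line _ _
    by_cases hcy' : c = y'
    · rw [hcy']; exact right_mem_line _ _
    rw [mem_line_iff hyy, hd, (h8 c hcy hcy').1.dist_eq_one, (h8 c hcy hcy').2.symm.dist_eq_one]
    exact .inl rfl
  have := hc.ncard_lines_removed_add_three_le hxz hux.symm huz.symm hN hN'
    (fun c h1 h2 h3 => (hall c h1 h2 h3).1) huniv
  omega
termination_by Fintype.card V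

/-- With fewer lines than vertices, `G` has a universal line: either `G` has two vertices only, or
it is exceptional and two non-adjacent vertices generate the universal line. -/
theorem LocallyConnected.univ_mem_lines_of_lt [Fintype V] (hl : G.LocallyConnected)
    (hc : G.Connected) (h : G.lines.ncard < Fintype.card V) : Set.univ ∈ G.lines := by
  classical
  obtain ⟨v⟩ := hc.nonempty
  obtain ⟨⟨b, hb⟩⟩ := (hl v).nonempty
  have hb' : G.Adj v b := hb
  by_cases hn : 3 ≤ Fintype.card V
  · have hE := ((hl.card_le_ncard_lines_or hc hn).resolve_left (not_le.2 h)).1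
    have hnonadj : ∃ x u, x ≠ u ∧ ¬ G.Adj x u := by
      by_contra! hcomplete
      have htf : Function.Injective G.neighborSet := fun x y hxy => by
        by_contra hne
        exact not_adj_of_neighborSet_eq hxy (hcomplete x y hne)
      exact not_le.2 h (hl.card_le_ncard_lines_of_injective hc htf hn)
    obtain ⟨x, u, hxu, hadj⟩ := hnonadj
    have h1 := (hE.of_not_adj hxu hadj).1
    obtain ⟨t, ht, htd⟩ := hc.exists_adj_dist hxu
    have htu : t ≠ u := by
      rintro rfl
      exact hadj ht
    have hd : G.dist x u = 2 := by
      rw [htd, (h1 t ht.ne' htu).2.symm.dist_eq_one]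
    refine ⟨x, u, hxu, (Set.eq_univ_of_forall fun c => ?_).symm⟩
    by_cases hcx : c = x
    · rw [hcx]; exact left_mem_line _ _
    by_cases hcu : c = u
    · rw [hcu]; exact right_mem_line _ _
    rw [mem_line_iff hxu, hd, (h1 c hcx hcu).1.dist_eq_one, (h1 c hcx hcu).2.symm.dist_eq_one]
    exact .inl rfl
  · have h2 : ({v, b} : Finset V) = Finset.univ := by
      rw [← Finset.card_eq_iff_eq_univ]
      have := Finset.card_le_univ ({v, b} : Finset V)
      rw [Finset.card_pair hb'.ne] at this ⊢
      omega
    refine ⟨v, b, hb'.ne, (Set.eq_univ_of_forall fun c => ?_).symm⟩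
    have h3 := h2 ▸ Finset.mem_univ c
    rw [Finset.mem_insert, Finset.mem_singleton] at h3
    rcases h3 with rfl | rfl
    · exact left_mem_line _ _
    · exact right_mem_line _ _

end SimpleGraph

theorem theorem1 {V : Type*} [Fintype V] (G : SimpleGraph V)
    (hconn : G.Connected) (hloc : G.LocallyConnected) :
    (3 ≤ Fintype.card V →
      (G.lines.ncard < Fintype.card V ↔
        Nonempty (G ≃g K122) ∨ Nonempty (G ≃g K222) ∨ Nonempty (G ≃g K2222))) ∧
    (Fintype.card V ≤ G.lines.ncard ∨ Set.univ ∈ G.lines) := by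
  refine ⟨fun hn => ⟨fun h => ?_, hconn.ncard_lines_lt_of_isExceptional⟩, ?_⟩
  · exact ((hloc.card_le_ncard_lines_or hconn hn).resolve_left (not_le.2 h)).1
  · exact or_iff_not_imp_left.2 fun h => hloc.univ_mem_lines_of_lt hconn (not_le.1 h)
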